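/- Let $\mathbb T=\mathbb R/\mathbb Z$ and let $L^1(\mathbb T)$ be the Banach space of complex-valued Lebesgue-integrable functions on $\mathbb T$ (modulo equality almost everywhere), with the norm $\|f\|_1=\int_{\mathbb T}|f|$. For $f\in L^1(\mathbb T)$ and $n\ge 0$ let $S_nf(x)=\sum_{k=-n}^{n}\hat f(k)e^{2\pi i kx}$, with $\hat f(k)=\int_{\mathbb T}f(t)e^{-2\pi i kt}\,dt$, be the $n$-th partial sum of the Fourier series of $f$. For $\beta\in\mathbb R$ put $$E(\beta,f)=\Big\{x\in\mathbb T:\ \limsup_{n\to+\infty}\frac{\log|S_nf(x)|}{\log n}=\beta\Big\}$$ (with $\log 0=-\infty$). Then for quasi-all $f\in L^1(\mathbb T)$, that is, for all $f$ in a residual (comeagre) subset of $L^1(\mathbb T)$, the Hausdorff dimension of $E(\beta,f)$ satisfies $$\dim_{\mathcal H}E(\beta,f)=1-\beta\qquad\text{for every }\beta\in[0,1].$$ -/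

import Mathlib

open MeasureTheory Filter
open scoped ENNReal

/-- The space `L¹(𝕋)` of (classes of) integrable complex functions on the circle `𝕋 = ℝ/ℤ`,
with its normalized Lebesgue (Haar) measure and the `L¹` norm. -/
abbrev L1Circle : Type :=
  Lp ℂ 1 (AddCircle.haarAddCircle : Measure UnitAddCircle)

/-- The `n`-th partial sum `S_n f (x) = ∑_{k=-n}^{n} ⟨f, e_k⟩ e_k(x)` of the Fourier series of `f`,
where `e_k(x) = exp (2 π i k x)`. -/
noncomputable def fourierPartialSum (n : ℕ) (f : UnitAddCircle → ℂ) (x : UnitAddCircle) : ℂ :=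
  ∑ k ∈ Finset.Icc (-(n : ℤ)) (n : ℤ), fourierCoeff f k * fourier k x

/-- The level set `E(β, f)` of all `x` with `limsup_{n → ∞} log |S_n f (x)| / log n = β`.
The logarithm and the upper limit are taken in the extended reals, with `log 0 = -∞`. -/
noncomputable def divergenceLevelSet (β : ℝ) (f : UnitAddCircle → ℂ) : Set UnitAddCircle :=
  {x | limsup (fun n : ℕ => ENNReal.log ‖fourierPartialSum n f x‖ₑ / ((Real.log n : ℝ) : EReal))
    atTop = (β : EReal)}

/-! Upper bound, for every integrable `f`. The Dirichlet kernel is dominated by a sum over scales of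
`2 ^ (k + 2)` times the indicator of the ball of radius `2 ^ (-k)`. If the measure `|f| dt` gives
mass `O(2 ^ (-k s))` to these balls around `x`, a geometric sum gives `S_n f(x) = O(n ^ (1 - s))`.
Growth faster than `n ^ γ` with `γ > 1 - s` thus needs heavy balls at infinitely many scales, and a
finite measure has such balls only on a set of dimension at most `s`. Letting `s` decrease to `1 -
γ` gives `dimH_fastGrowthSet_le`.

Lower bound, for generic `f`. For infinitely many `N`, `f` is extremely close to a polynomial of
degree at most `N` plus `1 / N` times a Fejér kernel dilated by `2 ^ N`
(`eventually_residual_frequently_hasSpikeAt`). At distance at most `2 ^ (-m)` from a dyadic rational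
of denominator `2 ^ N`, the partial sum of order `2 ^ (m - 3)` has size about `2 ^ (m - N) / N`.
With `m` about `N / (1 - β)`, this is growth of exponent `β`. The condition on `f` does not involve
`β`, so one residual set serves all `β`.

Points approximated this well along a sparse sequence of `N` are obtained by inserting long blocks
of zeros into binary expansions (`exists_map_near_dyadic`); the inverse of this map is Hölder of
every exponent `s < 1 - β`. All its values have growth exponent at least `β`. By the upper bound,
those with exponent above `β` pull back to a null set, so the level set pulls back to a set of full
measure and has dimension at least `s` (`le_dimH_divergenceLevelSet`). -/

/-! ### Dyadic covers and upper densities of finite measures -/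

/-- The half-open dyadic interval `[i / 2 ^ k, (i + 1) / 2 ^ k)`. -/
def dyadicCell (k : ℕ) (i : ℤ) : Set ℝ := {y | ⌊(2 : ℝ) ^ k * y⌋ = i}

lemma measurableSet_dyadicCell (k : ℕ) (i : ℤ) : MeasurableSet (dyadicCell k i) :=
  measurableSet_eq_fun (by fun_prop) measurable_const

lemma tsum_measure_dyadicCell (μ : Measure ℝ) (k : ℕ) :
    ∑' i : ℤ, μ (dyadicCell k i) = μ Set.univ := by
  rw [← measure_iUnion _ (measurableSet_dyadicCell k)]
  · congr 1
    ext y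
    simp [dyadicCell]
  · intro i j hij
    refine Set.disjoint_left.2 fun y hy hy' => hij ?_
    exact hy.symm.trans hy'

/-- A ball of radius `2 ^ (-k)` lies in three adjacent cells, one of which carries a third of its
mass. Passing to cells makes the covering sets disjoint in mass, so no Vitali-type covering lemma is
needed. -/
lemma exists_dyadicCell_of_lt_measure_closedBall {μ : Measure ℝ} {k : ℕ} {x : ℝ} {c : ℝ≥0∞}
    (h : 3 * c < μ (Metric.closedBall x ((2 : ℝ) ^ k)⁻¹)) :
    ∃ i : ℤ, c < μ (dyadicCell k i) ∧ x ∈ Metric.closedBall ((i : ℝ) / 2 ^ k) (2 * ((2 : ℝ) ^ k)⁻¹) := by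
  have hk : (0 : ℝ) < 2 ^ k := by positivity
  set i := ⌊(2 : ℝ) ^ k * x⌋ with hi
  have h1 : (i : ℝ) ≤ 2 ^ k * x := Int.floor_le _
  have h2 : (2 : ℝ) ^ k * x < i + 1 := Int.lt_floor_add_one _
  have hsub : Metric.closedBall x ((2 : ℝ) ^ k)⁻¹ ⊆
      dyadicCell k (i - 1) ∪ dyadicCell k i ∪ dyadicCell k (i + 1) := by
    intro y hy
    rw [Metric.mem_closedBall, Real.dist_eq, abs_le] at hy
    have e : (2 : ℝ) ^ k * ((2 : ℝ) ^ k)⁻¹ = 1 := mul_inv_cancel₀ hk.ne'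
    have h3 : (2 : ℝ) ^ k * y ≤ 2 ^ k * x + 1 := by nlinarith
    have h4 : (2 : ℝ) ^ k * x - 1 ≤ 2 ^ k * y := by nlinarith
    have h5 : i - 1 ≤ ⌊(2 : ℝ) ^ k * y⌋ := by
      rw [Int.le_floor]; push_cast; linarith
    have h6 : ⌊(2 : ℝ) ^ k * y⌋ < i + 2 := by
      rw [Int.floor_lt]; push_cast; linarith
    simp only [Set.mem_union, dyadicCell, Set.mem_ofPred_eq]
    omega
  have hex : ∃ j : ℤ, i - 1 ≤ j ∧ j ≤ i + 1 ∧ c < μ (dyadicCell k j) := by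
    by_contra! hcon
    refine absurd h (not_lt.2 ?_)
    calc _ ≤ _ := measure_mono hsub
      _ ≤ μ (dyadicCell k (i - 1)) + μ (dyadicCell k i) + μ (dyadicCell k (i + 1)) :=
        (measure_union_le _ _).trans (add_le_add_left (measure_union_le _ _) _)
      _ ≤ c + c + c := by
        gcongr <;> apply hcon <;> omega
      _ = 3 * c := by ring
  obtain ⟨j, hj1, hj2, hj⟩ := hex
  refine ⟨j, hj, ?_⟩
  have hj1' : (i : ℝ) - 1 ≤ j := by exact_mod_cast hj1
  have hj2' : (j : ℝ) ≤ i + 1 := by exact_mod_cast hj2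
  rw [Metric.mem_closedBall, Real.dist_eq]
  have : x - j / 2 ^ k = (2 ^ k * x - j) * ((2 : ℝ) ^ k)⁻¹ := by field_simp
  rw [this, abs_mul, abs_of_pos (inv_pos.2 hk)]
  gcongr
  rw [abs_le]; constructor <;> linarith

/-- The set of points around which a finite measure has upper density of order `s` along dyadic
radii has Hausdorff dimension at most `s`. -/
theorem dimH_setOf_frequently_lt_measure_closedBall (μ : Measure ℝ) [IsFiniteMeasure μ] (s : NNReal) :
    dimH {x : ℝ | ∃ᶠ k : ℕ in atTop,
      3 * ((2 : ℝ≥0∞) ^ k) ^ (-(s : ℝ)) < μ (Metric.closedBall x ((2 : ℝ) ^ k)⁻¹)} ≤ s := by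
  set B := {x : ℝ | ∃ᶠ k : ℕ in atTop,
      3 * ((2 : ℝ≥0∞) ^ k) ^ (-(s : ℝ)) < μ (Metric.closedBall x ((2 : ℝ) ^ k)⁻¹)} with hB
  refine le_of_forall_gt_imp_ge_of_dense fun d hd => ?_
  obtain ⟨d', hd', hd'd⟩ := ENNReal.lt_iff_exists_nnreal_btwn.1 hd
  refine le_trans ?_ hd'd.le
  have hsd : s < d' := by exact_mod_cast hd'
  have hd0 : 0 < (d' : ℝ) := lt_of_le_of_lt s.2 (by exact_mod_cast hsd)
  apply dimH_le_of_hausdorffMeasure_ne_top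
  classical
  -- The `K`-th cover uses only the heavy cells of generation at least `K`, enlarged to balls that
  -- contain the points found by the previous lemma.
  let t : ℕ → ℕ × ℤ → Set ℝ := fun K p =>
    if K ≤ p.1 ∧ ((2 : ℝ≥0∞) ^ p.1) ^ (-(s : ℝ)) < μ (dyadicCell p.1 p.2) then
      Metric.closedBall ((p.2 : ℝ) / 2 ^ p.1) (2 * ((2 : ℝ) ^ p.1)⁻¹) else ∅
  have hdiam : ∀ (k : ℕ) (c : ℝ), Metric.ediam (Metric.closedBall c (2 * ((2 : ℝ) ^ k)⁻¹)) ≤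
      4 * ((2 : ℝ≥0∞) ^ k)⁻¹ := by
    intro k c
    rw [Real.closedBall_eq_Icc, Real.ediam_Icc]
    have : c + 2 * ((2 : ℝ) ^ k)⁻¹ - (c - 2 * ((2 : ℝ) ^ k)⁻¹) = 4 * ((2 : ℝ) ^ k)⁻¹ := by ring
    rw [this, ENNReal.ofReal_mul (by norm_num), ENNReal.ofReal_inv_of_pos (by positivity),
      ENNReal.ofReal_pow (by norm_num)]
    norm_num
  have key := Measure.hausdorffMeasure_le_liminf_tsum (d' : ℝ) B (l := atTop)
    (r := fun K : ℕ => 4 * ((2 : ℝ≥0∞) ^ K)⁻¹) ?_ t ?_ ?_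
  · refine ne_top_of_le_ne_top ?_ key
    set ρ : ℝ≥0∞ := (2 : ℝ≥0∞) ^ ((s : ℝ) - d') with hρ
    have hρ1 : ρ < 1 := by
      rw [hρ]
      apply ENNReal.rpow_lt_one_of_one_lt_of_neg (by norm_num)
      have : (s : ℝ) < d' := by exact_mod_cast hsd
      linarith
    -- The factor `2 ^ (-k s)` in the diameter power is paid for by the mass of the heavy cell; the
    -- rest is the convergent geometric factor `ρ ^ k`.
    have hterm : ∀ K k i, (Metric.ediam (t K (k, i))) ^ (d' : ℝ) ≤
        (4 : ℝ≥0∞) ^ (d' : ℝ) * ρ ^ k * μ (dyadicCell k i) := by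
      intro K k i
      by_cases hc : K ≤ k ∧ ((2 : ℝ≥0∞) ^ k) ^ (-(s : ℝ)) < μ (dyadicCell k i)
      · simp only [t, hc, and_self, if_true]
        calc _ ≤ (4 * ((2 : ℝ≥0∞) ^ k)⁻¹) ^ (d' : ℝ) :=
              ENNReal.rpow_le_rpow (hdiam _ _) d'.coe_nonneg
          _ = (4 : ℝ≥0∞) ^ (d' : ℝ) * ρ ^ k * ((2 : ℝ≥0∞) ^ k) ^ (-(s : ℝ)) := by
            rw [ENNReal.mul_rpow_of_nonneg _ _ d'.coe_nonneg, mul_assoc]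
            congr 1
            rw [← ENNReal.rpow_natCast, ← ENNReal.rpow_neg, ← ENNReal.rpow_mul, hρ,
              ← ENNReal.rpow_natCast, ← ENNReal.rpow_mul, ← ENNReal.rpow_mul,
              ← ENNReal.rpow_add _ _ (by norm_num) (by norm_num)]
            congr 1
            ring
          _ ≤ _ := by gcongr; exact hc.2.le
      · simp only [t, hc, if_false, Metric.ediam_empty]
        rw [ENNReal.zero_rpow_of_pos hd0]
        exact zero_le
    have hsum : ∀ K, ∑' p, (Metric.ediam (t K p)) ^ (d' : ℝ) ≤
        (4 : ℝ≥0∞) ^ (d' : ℝ) * (1 - ρ)⁻¹ * μ Set.univ := by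
      intro K
      rw [ENNReal.tsum_prod']
      calc _ ≤ ∑' k : ℕ, ∑' i : ℤ, (4 : ℝ≥0∞) ^ (d' : ℝ) * ρ ^ k * μ (dyadicCell k i) :=
            ENNReal.tsum_le_tsum fun k => ENNReal.tsum_le_tsum fun i => hterm K k i
        _ = ∑' k : ℕ, (4 : ℝ≥0∞) ^ (d' : ℝ) * ρ ^ k * μ Set.univ := by
            congr 1; ext k
            rw [ENNReal.tsum_mul_left, tsum_measure_dyadicCell]
        _ = _ := by
            rw [ENNReal.tsum_mul_right, ENNReal.tsum_mul_left, ENNReal.tsum_geometric]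
    refine ne_top_of_le_ne_top ?_ (liminf_le_of_le (by isBoundedDefault)
      (fun b hb => ?_ : ∀ b, _ → b ≤ (4 : ℝ≥0∞) ^ (d' : ℝ) * (1 - ρ)⁻¹ * μ Set.univ))
    · refine ENNReal.mul_ne_top (ENNReal.mul_ne_top ?_ ?_) (measure_ne_top _ _)
      · exact ENNReal.rpow_ne_top_of_nonneg d'.coe_nonneg (by norm_num)
      · exact ENNReal.inv_ne_top.2 (tsub_pos_of_lt hρ1).ne'
    · obtain ⟨K, hK⟩ := hb.exists
      exact hK.trans (hsum K)
  · have h0 : Tendsto (fun K : ℕ => ((2 : ℝ≥0∞)⁻¹) ^ K) atTop (nhds 0) :=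
      ENNReal.tendsto_pow_atTop_nhds_zero_of_lt_one (by simp)
    have := ENNReal.Tendsto.const_mul (a := 4) h0 (Or.inr (by norm_num))
    simpa [ENNReal.inv_pow] using this
  · refine Eventually.of_forall fun K p => ?_
    by_cases hc : K ≤ p.1 ∧ ((2 : ℝ≥0∞) ^ p.1) ^ (-(s : ℝ)) < μ (dyadicCell p.1 p.2)
    · simp only [t, hc, and_self, if_true]
      refine (hdiam _ _).trans ?_
      gcongr
      · norm_num
      · exact hc.1
    · simp [t, hc]
  · refine Eventually.of_forall fun K x hx => ?_
    obtain ⟨k, hk, hxk⟩ := (hx : ∃ᶠ k : ℕ in atTop, _).forall_exists_of_atTop K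
    obtain ⟨i, hi, hxi⟩ := exists_dyadicCell_of_lt_measure_closedBall hxk
    refine Set.mem_iUnion.2 ⟨(k, i), ?_⟩
    simp only [t]
    rw [if_pos ⟨hk, hi⟩]
    exact hxi

/-! ### The Dirichlet kernel and its dyadic majorant -/

/-- The Dirichlet kernel `∑_{|k| ≤ n} e_k` on the circle. -/
noncomputable def dirichletKernel (n : ℕ) (u : UnitAddCircle) : ℂ :=
  ∑ k ∈ Finset.Icc (-(n : ℤ)) (n : ℤ), fourier k u

lemma Finset.sum_Icc_neg_succ {M : Type*} [AddCommMonoid M] (g : ℤ → M) (n : ℕ) :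
    ∑ k ∈ Finset.Icc (-((n + 1 : ℕ) : ℤ)) ((n + 1 : ℕ) : ℤ), g k =
      g (n + 1) + (g (-(n + 1)) + ∑ k ∈ Finset.Icc (-(n : ℤ)) (n : ℤ), g k) := by
  have : Finset.Icc (-((n + 1 : ℕ) : ℤ)) ((n + 1 : ℕ) : ℤ) =
      insert ((n : ℤ) + 1) (insert (-((n : ℤ) + 1)) (Finset.Icc (-(n : ℤ)) (n : ℤ))) := by
    ext k
    simp only [Finset.mem_Icc, Finset.mem_insert]
    omega
  rw [this, Finset.sum_insert, Finset.sum_insert]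
  · simp only [Finset.mem_Icc]; omega
  · simp only [Finset.mem_insert, Finset.mem_Icc]; omega

lemma norm_fourier_apply (k : ℤ) (u : UnitAddCircle) : ‖fourier k u‖ = 1 := Circle.norm_coe _

lemma norm_dirichletKernel_le (n : ℕ) (u : UnitAddCircle) : ‖dirichletKernel n u‖ ≤ 2 * n + 1 := by
  refine (norm_sum_le _ _).trans ?_
  simp only [norm_fourier_apply, Finset.sum_const, Int.card_Icc, nsmul_eq_mul, mul_one]
  have : ((n : ℤ) + 1 - -(n : ℤ)).toNat = 2 * n + 1 := by omega
  rw [this]; push_cast; exact le_rfl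

/-- Telescoping; the product form avoids dividing by zero at `u = 0`. -/
lemma dirichletKernel_mul_sub_one (n : ℕ) (u : UnitAddCircle) :
    dirichletKernel n u * (fourier 1 u - 1) = fourier (n + 1 : ℤ) u - fourier (-n : ℤ) u := by
  induction n with
  | zero => simp [dirichletKernel]
  | succ n ih =>
    rw [dirichletKernel, Finset.sum_Icc_neg_succ, add_mul, add_mul]
    rw [dirichletKernel] at ih
    rw [ih]
    have h1 : fourier ((n + 1 : ℕ) + 1 : ℤ) u = fourier (n + 1 : ℤ) u * fourier 1 u := by
      rw [← fourier_add]; push_cast; rfl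
    have h2 : fourier (-n : ℤ) u = fourier (-(n + 1) : ℤ) u * fourier 1 u := by
      rw [← fourier_add]; congr 2; ring
    rw [h1, h2]
    push_cast
    ring

/-- With `y` the representative of `u` nearest to `0`, the right side is `2 |sin (π y)|`, and
Jordan's inequality applies since `|y| ≤ 1 / 2`. -/
lemma four_mul_norm_le_norm_fourier_one_sub_one (u : UnitAddCircle) :
    4 * ‖u‖ ≤ ‖fourier 1 u - 1‖ := by
  induction u using QuotientAddGroup.induction_on with | H x =>
  have hx : ((x : ℝ) : UnitAddCircle) = ((x - round x : ℝ) : UnitAddCircle) := by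
    rw [AddCircle.coe_sub, eq_comm, sub_eq_self]
    exact (AddCircle.coe_eq_zero_iff 1).2 ⟨round x, by simp⟩
  change 4 * ‖(x : UnitAddCircle)‖ ≤ ‖fourier 1 (x : UnitAddCircle) - 1‖
  rw [UnitAddCircle.norm_eq, hx, fourier_coe_apply]
  set y := x - round x
  have hy : |y| ≤ 1 / 2 := abs_sub_round x
  have e : (2 * Real.pi * Complex.I * (1 : ℤ) * y / (1 : ℝ) : ℂ) =
      Complex.I * ((2 * Real.pi * y : ℝ) : ℂ) := by
    push_cast; ring
  rw [e, Complex.norm_exp_I_mul_ofReal_sub_one, norm_mul, Real.norm_eq_abs, Real.norm_eq_abs]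
  have hpi := Real.pi_pos
  have := Real.mul_abs_le_abs_sin (x := 2 * Real.pi * y / 2) (by
    rw [show 2 * Real.pi * y / 2 = Real.pi * y by ring, abs_mul, abs_of_pos hpi]
    nlinarith)
  rw [show |2 * Real.pi * y / 2| = Real.pi * |y| by
    rw [show 2 * Real.pi * y / 2 = Real.pi * y by ring, abs_mul, abs_of_pos hpi]] at this
  have e2 : 2 / Real.pi * (Real.pi * |y|) = 2 * |y| := by field_simp
  rw [e2] at this
  rw [abs_of_pos (by norm_num : (0 : ℝ) < 2)]
  linarith

lemma norm_dirichletKernel_mul_norm_le (n : ℕ) (u : UnitAddCircle) :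
    ‖dirichletKernel n u‖ * ‖u‖ ≤ 1 / 2 := by
  have h := congrArg norm (dirichletKernel_mul_sub_one n u)
  rw [norm_mul] at h
  have h2 : ‖fourier (n + 1 : ℤ) u - fourier (-n : ℤ) u‖ ≤ 2 := by
    refine (norm_sub_le _ _).trans ?_
    rw [norm_fourier_apply, norm_fourier_apply]; norm_num
  have h3 := four_mul_norm_le_norm_fourier_one_sub_one u
  have := mul_le_mul_of_nonneg_left h3 (norm_nonneg (dirichletKernel n u))
  linarith

/-- Dyadic majorant of the Dirichlet kernel. -/
lemma norm_dirichletKernel_le_sum {n K : ℕ} (hn : n < 2 ^ (K + 1)) (u : UnitAddCircle) :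
    ‖dirichletKernel n u‖ ≤ ∑ k ∈ Finset.range (K + 1),
      (2 : ℝ) ^ (k + 2) * (if ‖u‖ ≤ ((2 : ℝ) ^ k)⁻¹ then 1 else 0) := by
  have hnn : ∀ k ∈ Finset.range (K + 1),
      0 ≤ (2 : ℝ) ^ (k + 2) * (if ‖u‖ ≤ ((2 : ℝ) ^ k)⁻¹ then 1 else 0) := by
    intro k _; split_ifs <;> positivity
  -- A single term of the sum suffices: the scale of `‖u‖`, cut off at `K`, where the trivial bound
  -- `2 n + 1` takes over.
  suffices h : ∃ k ≤ K, ‖u‖ ≤ ((2 : ℝ) ^ k)⁻¹ ∧ ‖dirichletKernel n u‖ ≤ 2 ^ (k + 2) by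
    obtain ⟨k, hk, hu, hD⟩ := h
    refine le_trans ?_ (Finset.single_le_sum hnn (Finset.mem_range.2 (Nat.lt_succ_of_le hk)))
    simpa [hu] using hD
  have hu1 : ‖u‖ ≤ 1 / 2 := by
    have := AddCircle.norm_le_half_period (1 : ℝ) (x := u) one_ne_zero
    simpa using this
  by_cases hK : ‖u‖ ≤ ((2 : ℝ) ^ K)⁻¹
  · refine ⟨K, le_rfl, hK, (norm_dirichletKernel_le n u).trans ?_⟩
    have : (n : ℝ) + 1 ≤ 2 ^ (K + 1) := by exact_mod_cast hn
    have e : (2 : ℝ) ^ (K + 2) = 2 * 2 ^ (K + 1) := by ring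
    rw [e]; linarith
  · push Not at hK
    have hex : ∃ k, ((2 : ℝ) ^ k)⁻¹ < ‖u‖ := ⟨K, hK⟩
    classical
    obtain ⟨hk1, hk2⟩ := And.intro (Nat.find_spec hex) (fun m => Nat.find_min hex (m := m))
    have hkK : Nat.find hex ≤ K := Nat.find_min' hex hK
    set k := Nat.find hex
    have hk0 : k ≠ 0 := by
      rintro h0
      rw [h0] at hk1
      norm_num at hk1
      linarith
    obtain ⟨j, hj⟩ := Nat.exists_eq_succ_of_ne_zero hk0
    refine ⟨j, by omega, not_lt.1 (hk2 j (by omega)), ?_⟩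
    have h := norm_dirichletKernel_mul_norm_le n u
    rw [hj] at hk1
    have hp : (0 : ℝ) < 2 ^ j := by positivity
    have h3 : ‖dirichletKernel n u‖ * ((2 : ℝ) ^ (j + 1))⁻¹ ≤ 1 / 2 :=
      (mul_le_mul_of_nonneg_left hk1.le (norm_nonneg _)).trans h
    rw [← div_eq_mul_inv, div_le_iff₀ (by positivity)] at h3
    refine h3.trans ?_
    rw [pow_add, pow_add]
    linarith

lemma fourierPartialSum_eq_integral {f : UnitAddCircle → ℂ}
    (hf : Integrable f AddCircle.haarAddCircle) (n : ℕ) (x : UnitAddCircle) :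
    fourierPartialSum n f x = ∫ t, f t * dirichletKernel n (x - t) ∂AddCircle.haarAddCircle := by
  have h : ∀ t, f t * dirichletKernel n (x - t) =
      ∑ k ∈ Finset.Icc (-(n : ℤ)) (n : ℤ), (fourier (-k) t • f t) * fourier k x := by
    intro t
    rw [dirichletKernel, Finset.mul_sum]
    refine Finset.sum_congr rfl fun k _ => ?_
    have : fourier k (x - t) = fourier k x * fourier (-k) t := by
      have e : k • (x - t) = k • x + (-k) • t := by rw [zsmul_sub, neg_zsmul, sub_eq_add_neg]
      rw [fourier_apply, fourier_apply, fourier_apply, e, AddCircle.toCircle_add, Circle.coe_mul]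
    rw [this, smul_eq_mul]; ring
  simp_rw [h]
  rw [integral_finsetSum]
  · refine Finset.sum_congr rfl fun k _ => ?_
    rw [integral_mul_const]; rfl
  · intro k _
    exact (hf.fourier_smul (-k)).mul_const _

/-! ### Partial sums controlled by the mass of balls -/

/-- The finite measure `|f| dt` on the circle. -/
noncomputable def absMeasure (f : UnitAddCircle → ℂ) : Measure UnitAddCircle :=
  (AddCircle.haarAddCircle : Measure UnitAddCircle).withDensity fun t => ‖f t‖ₑ

lemma isFiniteMeasure_absMeasure {f : UnitAddCircle → ℂ}
    (hf : Integrable f AddCircle.haarAddCircle) : IsFiniteMeasure (absMeasure f) :=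
  isFiniteMeasure_withDensity hf.2.ne

lemma norm_fourierPartialSum_le_sum {f : UnitAddCircle → ℂ}
    (hf : Integrable f AddCircle.haarAddCircle) {n K : ℕ} (hn : n < 2 ^ (K + 1))
    (x : UnitAddCircle) :
    ‖fourierPartialSum n f x‖ ≤ ∑ k ∈ Finset.range (K + 1),
      (2 : ℝ) ^ (k + 2) * (absMeasure f).real (Metric.closedBall x ((2 : ℝ) ^ k)⁻¹) := by
  rw [fourierPartialSum_eq_integral hf]
  refine (norm_integral_le_integral_norm _).trans ?_
  have hball : ∀ k : ℕ, (absMeasure f).real (Metric.closedBall x ((2 : ℝ) ^ k)⁻¹) =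
      ∫ t, (Metric.closedBall x ((2 : ℝ) ^ k)⁻¹).indicator (fun t => ‖f t‖) t
        ∂AddCircle.haarAddCircle := by
    intro k
    rw [integral_indicator Metric.isClosed_closedBall.measurableSet, Measure.real, absMeasure,
      withDensity_apply _ Metric.isClosed_closedBall.measurableSet,
      integral_norm_eq_lintegral_enorm hf.1.restrict]
  have hint : ∀ k : ℕ, Integrable
      ((Metric.closedBall x ((2 : ℝ) ^ k)⁻¹).indicator (fun t => ‖f t‖))
        (AddCircle.haarAddCircle : Measure UnitAddCircle) := fun k =>
    hf.norm.indicator Metric.isClosed_closedBall.measurableSet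
  simp_rw [hball, ← integral_const_mul]
  rw [← integral_finsetSum _ fun k _ => (hint k).const_mul _]
  refine integral_mono_of_nonneg (Eventually.of_forall fun t => norm_nonneg _)
    (integrable_finsetSum _ fun k _ => (hint k).const_mul _) (Eventually.of_forall fun t => ?_)
  simp only [norm_mul]
  refine (mul_le_mul_of_nonneg_left (norm_dirichletKernel_le_sum hn (x - t))
    (norm_nonneg _)).trans (le_of_eq ?_)
  rw [Finset.mul_sum]
  refine Finset.sum_congr rfl fun k _ => ?_
  simp only [Set.indicator, Metric.mem_closedBall, dist_comm t x, dist_eq_norm]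
  split_ifs <;> ring

lemma exists_norm_fourierPartialSum_le_rpow {f : UnitAddCircle → ℂ}
    (hf : Integrable f AddCircle.haarAddCircle) {s : ℝ} (hs0 : 0 < s) (hs1 : s < 1)
    {x : UnitAddCircle}
    (hx : ∀ᶠ k : ℕ in atTop, (absMeasure f) (Metric.closedBall x ((2 : ℝ) ^ k)⁻¹) ≤
      3 * ((2 : ℝ≥0∞) ^ k) ^ (-s)) :
    ∃ C : ℝ, ∀ n : ℕ, 1 ≤ n → ‖fourierPartialSum n f x‖ ≤ C * (n : ℝ) ^ (1 - s) := by
  have := isFiniteMeasure_absMeasure hf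
  obtain ⟨k₀, hk₀⟩ := eventually_atTop.1 hx
  set ν := absMeasure f
  -- The second summand absorbs the scales below `k₀`, where only the total mass is known.
  set C : ℝ := 3 + ν.real Set.univ * ((2 : ℝ) ^ k₀) ^ s with hC
  have hC0 : 0 ≤ C := by positivity
  have hb : ∀ k : ℕ, ν.real (Metric.closedBall x ((2 : ℝ) ^ k)⁻¹) ≤ C * ((2 : ℝ) ^ k) ^ (-s) := by
    intro k
    rcases le_total k₀ k with hk | hk
    · have h1 := ENNReal.toReal_mono (ENNReal.mul_ne_top (by norm_num)
        (ENNReal.rpow_ne_top_of_ne_zero (by simp) (by simp))) (hk₀ k hk)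
      rw [ENNReal.toReal_mul, ← ENNReal.toReal_rpow, ENNReal.toReal_pow] at h1
      refine h1.trans ?_
      simp only [ENNReal.toReal_ofNat]
      gcongr
      rw [hC]
      have : 0 ≤ ν.real Set.univ * ((2 : ℝ) ^ k₀) ^ s := by positivity
      linarith
    · have h1 : (1 : ℝ) ≤ ((2 : ℝ) ^ k₀) ^ s * ((2 : ℝ) ^ k) ^ (-s) := by
        rw [Real.rpow_neg (by positivity), ← div_eq_mul_inv, le_div_iff₀ (by positivity), one_mul]
        have : (2 : ℝ) ^ k ≤ 2 ^ k₀ := pow_le_pow_right₀ (by norm_num) hk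
        gcongr
      calc ν.real (Metric.closedBall x ((2 : ℝ) ^ k)⁻¹) ≤ ν.real Set.univ :=
            measureReal_mono (Set.subset_univ _)
        _ = ν.real Set.univ * 1 := by ring
        _ ≤ ν.real Set.univ * (((2 : ℝ) ^ k₀) ^ s * ((2 : ℝ) ^ k) ^ (-s)) := by gcongr
        _ ≤ _ := by
          rw [← mul_assoc]
          gcongr
          rw [hC]; linarith
  set ρ : ℝ := (2 : ℝ) ^ (1 - s) with hρ
  have hρ1 : 1 < ρ := Real.one_lt_rpow (by norm_num) (by linarith)
  refine ⟨4 * C * (ρ / (ρ - 1)), fun n hn => ?_⟩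
  set K := Nat.log 2 n
  have hK1 : 2 ^ K ≤ n := Nat.pow_log_le_self 2 (by omega)
  have hK2 : n < 2 ^ (K + 1) := Nat.lt_pow_succ_log_self (by norm_num) n
  have hterm : ∀ k : ℕ, (2 : ℝ) ^ (k + 2) * ν.real (Metric.closedBall x ((2 : ℝ) ^ k)⁻¹) ≤
      4 * C * ρ ^ k := by
    intro k
    have e : ρ ^ k = 2 ^ k * ((2 : ℝ) ^ k) ^ (-s) := by
      rw [hρ, ← Real.rpow_natCast, ← Real.rpow_natCast, ← Real.rpow_mul (by norm_num),
        ← Real.rpow_mul (by norm_num), ← Real.rpow_add (by norm_num)]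
      congr 1; ring
    calc _ ≤ (2 : ℝ) ^ (k + 2) * (C * ((2 : ℝ) ^ k) ^ (-s)) := by gcongr; exact hb k
      _ = 4 * C * ρ ^ k := by rw [e]; ring
  calc _ ≤ _ := norm_fourierPartialSum_le_sum hf hK2 x
    _ ≤ ∑ k ∈ Finset.range (K + 1), 4 * C * ρ ^ k := Finset.sum_le_sum fun k _ => hterm k
    _ = 4 * C * ((ρ ^ (K + 1) - 1) / (ρ - 1)) := by
      rw [← Finset.mul_sum, geom_sum_eq hρ1.ne']
    _ ≤ 4 * C * (ρ ^ (K + 1) / (ρ - 1)) := by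
      gcongr; all_goals linarith
    _ = 4 * C * (ρ / (ρ - 1)) * ρ ^ K := by ring
    _ ≤ _ := by
      have h0 : 0 < ρ - 1 := by linarith
      gcongr
      have e : ρ ^ K = ((2 : ℝ) ^ K) ^ (1 - s) := by
        rw [hρ, ← Real.rpow_natCast, ← Real.rpow_natCast, ← Real.rpow_mul (by norm_num),
          ← Real.rpow_mul (by norm_num)]
        congr 1; ring
      rw [e]
      apply Real.rpow_le_rpow (by positivity) _ (by linarith)
      exact_mod_cast hK1

/-! ### Upper bound for the dimension of the fast growth sets -/

/-- The points where the partial sums of the Fourier series of `f` exceed `n ^ γ` infinitely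
often. -/
def fastGrowthSet (γ : ℝ) (f : UnitAddCircle → ℂ) : Set UnitAddCircle :=
  {x | ∃ᶠ n : ℕ in atTop, (n : ℝ) ^ γ ≤ ‖fourierPartialSum n f x‖}

lemma frequently_lt_absMeasure_of_mem_fastGrowthSet {f : UnitAddCircle → ℂ}
    (hf : Integrable f AddCircle.haarAddCircle) {s γ : ℝ} (hs0 : 0 < s) (hs1 : s < 1)
    (hγ : 1 - γ < s) {x : UnitAddCircle} (hx : x ∈ fastGrowthSet γ f) :
    ∃ᶠ k : ℕ in atTop, 3 * ((2 : ℝ≥0∞) ^ k) ^ (-s) <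
      (absMeasure f) (Metric.closedBall x ((2 : ℝ) ^ k)⁻¹) := by
  by_contra hcon
  rw [not_frequently] at hcon
  simp only [not_lt] at hcon
  obtain ⟨C, hC⟩ := exists_norm_fourierPartialSum_le_rpow hf hs0 hs1 hcon
  have ht : Tendsto (fun n : ℕ => (n : ℝ) ^ (γ - (1 - s))) atTop atTop :=
    (tendsto_rpow_atTop (by linarith)).comp tendsto_natCast_atTop_atTop
  obtain ⟨n, hn, hn1, hn2⟩ := (Frequently.and_eventually hx
    ((eventually_ge_atTop 1).and (ht.eventually_gt_atTop C))).exists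
  have hn0 : (0 : ℝ) < n := by exact_mod_cast hn1
  have h1 := hn.trans (hC n hn1)
  rw [show γ = (γ - (1 - s)) + (1 - s) by ring, Real.rpow_add hn0] at h1
  have := le_of_mul_le_mul_right h1 (Real.rpow_pos_of_pos hn0 _)
  linarith

/-- The measure `|f| dt` lifted to the interval `[-1, 2]` of the real line. -/
noncomputable def liftedAbsMeasure (f : UnitAddCircle → ℂ) : Measure ℝ :=
  (volume.restrict (Set.Ioc (-1 : ℝ) 2)).withDensity fun y => ‖f (y : UnitAddCircle)‖ₑ

lemma UnitAddCircle.volume_eq_haarAddCircle :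
    (volume : Measure UnitAddCircle) = AddCircle.haarAddCircle := by
  rw [AddCircle.volume_eq_smul_haarAddCircle]; simp

lemma lintegral_Ioc_enorm_ne_top {f : UnitAddCircle → ℂ}
    (hf : Integrable f AddCircle.haarAddCircle) (a : ℝ) :
    ∫⁻ y in Set.Ioc a (a + 1), ‖f (y : UnitAddCircle)‖ₑ ≠ ∞ := by
  rw [UnitAddCircle.lintegral_preimage a (fun t => ‖f t‖ₑ), UnitAddCircle.volume_eq_haarAddCircle]
  exact hf.2.ne

lemma isFiniteMeasure_liftedAbsMeasure {f : UnitAddCircle → ℂ}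
    (hf : Integrable f AddCircle.haarAddCircle) : IsFiniteMeasure (liftedAbsMeasure f) := by
  apply isFiniteMeasure_withDensity
  have h : Set.Ioc (-1 : ℝ) 2 ⊆
      Set.Ioc (-1 : ℝ) (-1 + 1) ∪ (Set.Ioc (0 : ℝ) (0 + 1) ∪ Set.Ioc (1 : ℝ) (1 + 1)) := by
    intro y hy
    simp only [Set.mem_union, Set.mem_Ioc] at hy ⊢
    grind
  refine ne_top_of_le_ne_top ?_ (lintegral_mono_set h)
  refine ne_top_of_le_ne_top ?_ (lintegral_union_le _ _ _)
  refine ENNReal.add_ne_top.2 ⟨lintegral_Ioc_enorm_ne_top hf _, ?_⟩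
  refine ne_top_of_le_ne_top ?_ (lintegral_union_le _ _ _)
  exact ENNReal.add_ne_top.2 ⟨lintegral_Ioc_enorm_ne_top hf _, lintegral_Ioc_enorm_ne_top hf _⟩

/-- Integrate over the period `(x - 1/2, x + 1/2]`, where the distance to `x` on the circle is the
distance on the line. This window stays inside `(-1, 2]`, whence the choice of interval in
`liftedAbsMeasure`. -/
lemma absMeasure_closedBall_le (f : UnitAddCircle → ℂ) {x : ℝ} (hx : x ∈ Set.Ico (0 : ℝ) 1)
    (r : ℝ) : absMeasure f (Metric.closedBall (x : UnitAddCircle) r) ≤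
      liftedAbsMeasure f (Metric.closedBall x r) := by
  have hm : MeasurableSet (Metric.closedBall (x : UnitAddCircle) r) :=
    Metric.isClosed_closedBall.measurableSet
  rw [absMeasure, withDensity_apply _ hm, liftedAbsMeasure,
    withDensity_apply _ Metric.isClosed_closedBall.measurableSet,
    Measure.restrict_restrict Metric.isClosed_closedBall.measurableSet,
    ← lintegral_indicator hm, ← UnitAddCircle.volume_eq_haarAddCircle,
    ← UnitAddCircle.lintegral_preimage (x - 1 / 2),
    ← lintegral_indicator measurableSet_Ioc,
    ← lintegral_indicator (Metric.isClosed_closedBall.measurableSet.inter measurableSet_Ioc)]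
  refine lintegral_mono fun y => ?_
  by_cases hy : y ∈ Set.Ioc (x - 1 / 2) (x - 1 / 2 + 1)
  · rw [Set.indicator_of_mem hy]
    by_cases hyb : (y : UnitAddCircle) ∈ Metric.closedBall (x : UnitAddCircle) r
    · rw [Set.indicator_of_mem hyb, Set.indicator_of_mem]
      refine ⟨?_, ?_⟩
      · rw [Metric.mem_closedBall, dist_eq_norm, ← AddCircle.coe_sub,
          (AddCircle.norm_coe_eq_abs_iff 1 one_ne_zero).2] at hyb
        · rwa [Metric.mem_closedBall, Real.dist_eq]
        · rw [abs_one, abs_le]; constructor <;> linarith [hy.1, hy.2]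
      · exact ⟨by linarith [hy.1, hx.1], by linarith [hy.2, hx.2]⟩
    · rw [Set.indicator_of_notMem hyb]; exact zero_le
  · rw [Set.indicator_of_notMem hy]; exact zero_le

lemma lipschitzWith_coe_unitAddCircle : LipschitzWith 1 ((↑) : ℝ → UnitAddCircle) := by
  refine LipschitzWith.of_dist_le_mul fun x y => ?_
  rw [dist_eq_norm, ← AddCircle.coe_sub, UnitAddCircle.norm_eq, NNReal.coe_one, one_mul, Real.dist_eq]
  simpa using round_le (x - y) 0

lemma UnitAddCircle.exists_coe_eq (u : UnitAddCircle) :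
    ∃ x : ℝ, x ∈ Set.Ico (0 : ℝ) 1 ∧ (x : UnitAddCircle) = u := by
  refine ⟨AddCircle.equivIco 1 0 u, ?_, AddCircle.coe_equivIco⟩
  simpa using (AddCircle.equivIco 1 0 u).2

lemma dimH_unitAddCircle_le (s : Set UnitAddCircle) : dimH s ≤ 1 := by
  have : s ⊆ ((↑) : ℝ → UnitAddCircle) '' Set.univ := by
    intro u _
    obtain ⟨x, -, hx⟩ := UnitAddCircle.exists_coe_eq u
    exact ⟨x, trivial, hx⟩
  exact (dimH_mono this).trans
    ((lipschitzWith_coe_unitAddCircle.dimH_image_le _).trans Real.dimH_univ.le)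

/-- The partial sums of the Fourier series of an integrable function exceed `n ^ γ` infinitely often
on a set of Hausdorff dimension at most `1 - γ`. -/
theorem dimH_fastGrowthSet_le {f : UnitAddCircle → ℂ}
    (hf : Integrable f AddCircle.haarAddCircle) {γ : ℝ} (hγ : 0 < γ) :
    dimH (fastGrowthSet γ f) ≤ ENNReal.ofReal (1 - γ) := by
  have := isFiniteMeasure_liftedAbsMeasure hf
  refine le_of_forall_gt_imp_ge_of_dense fun d hd => ?_
  obtain ⟨s, hs, hsd⟩ := ENNReal.lt_iff_exists_nnreal_btwn.1
    (lt_min hd (show ENNReal.ofReal (1 - γ) < 1 by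
      rw [← ENNReal.ofReal_one]; exact (ENNReal.ofReal_lt_ofReal_iff one_pos).2 (by linarith)))
  have hs1 : (s : ℝ) < 1 := by exact_mod_cast hsd.trans_le (min_le_right _ _)
  have hsγ : 1 - γ < s := by
    rw [← ENNReal.ofReal_coe_nnreal, ENNReal.ofReal_lt_ofReal_iff'] at hs
    exact hs.1
  have hs0 : 0 < (s : ℝ) := by
    rw [← ENNReal.ofReal_coe_nnreal, ENNReal.ofReal_lt_ofReal_iff'] at hs
    exact hs.2
  refine le_trans ?_ (hsd.le.trans (min_le_left _ _))
  have hsub : fastGrowthSet γ f ⊆ ((↑) : ℝ → UnitAddCircle) '' {x : ℝ | ∃ᶠ k : ℕ in atTop,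
      3 * ((2 : ℝ≥0∞) ^ k) ^ (-(s : ℝ)) <
        liftedAbsMeasure f (Metric.closedBall x ((2 : ℝ) ^ k)⁻¹)} := by
    intro u hu
    obtain ⟨x, hx, rfl⟩ := UnitAddCircle.exists_coe_eq u
    refine ⟨x, ?_, rfl⟩
    exact (frequently_lt_absMeasure_of_mem_fastGrowthSet hf hs0 hs1 hsγ hu).mono fun k hk =>
      hk.trans_le (absMeasure_closedBall_le f hx _)
  exact (dimH_mono hsub).trans ((lipschitzWith_coe_unitAddCircle.dimH_image_le _).trans
    (dimH_setOf_frequently_lt_measure_closedBall _ s))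

/-! ### Spreading binary digits over prescribed positions -/

section InsertDigits

variable (P : ℕ → Prop) [DecidablePred P]

/-- Spread the binary digits of an integer over the positions `< n` satisfying `P`, and put zeros at
the other positions. Position `0` is the most significant one. -/
def insertDigits : ℕ → ℕ → ℕ
  | 0, a => a
  | n + 1, a => if P n then 2 * insertDigits n (a / 2) + a % 2 else 2 * insertDigits n a

/-- The base case of `insertDigits` keeps all leftover leading digits, so no information is lost and
strictness holds on all of `ℕ`. -/
lemma insertDigits_strictMono (n : ℕ) : StrictMono (insertDigits P n) := by
  induction n with
  | zero => exact strictMono_id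
  | succ n ih =>
    intro a b hab
    simp only [insertDigits]
    split_ifs
    · rcases (Nat.div_le_div_right hab.le : a / 2 ≤ b / 2).lt_or_eq with h | h
      · have := ih h
        have := Nat.mod_lt a two_pos
        omega
      · rw [h]; omega
    · have := ih hab
      omega

/-- The integer formed by the first `n` binary digits of the image of `t` under `digitMap`. -/
noncomputable def digitApprox (n : ℕ) (t : ℝ) : ℕ :=
  insertDigits P n ⌊(2 : ℝ) ^ (Nat.count P n) * t⌋₊

/-- The map spreading the binary digits of `t ∈ [0, 1)` over the positions satisfying `P`. -/
noncomputable def digitMap (t : ℝ) : ℝ := ⨆ n, (digitApprox P n t : ℝ) / 2 ^ n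

variable {P}

lemma digitApprox_succ_of_not {n : ℕ} (h : ¬ P n) (t : ℝ) :
    digitApprox P (n + 1) t = 2 * digitApprox P n t := by
  simp [digitApprox, insertDigits, h, Nat.count_succ]

lemma digitApprox_succ_bounds (n : ℕ) (t : ℝ) :
    2 * digitApprox P n t ≤ digitApprox P (n + 1) t ∧
      digitApprox P (n + 1) t ≤ 2 * digitApprox P n t + 1 := by
  by_cases h : P n
  · have e : ⌊(2 : ℝ) ^ (Nat.count P n + 1) * t⌋₊ / 2 = ⌊(2 : ℝ) ^ (Nat.count P n) * t⌋₊ := by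
      have := Nat.floor_div_natCast ((2 : ℝ) ^ (Nat.count P n + 1) * t) 2
      rw [← this]
      congr 1
      push_cast
      ring
    simp only [digitApprox, insertDigits, h, if_true, Nat.count_succ, e]
    have := Nat.mod_lt ⌊(2 : ℝ) ^ (Nat.count P n + 1) * t⌋₊ two_pos
    omega
  · rw [digitApprox_succ_of_not h]; omega

lemma monotone_digitApprox_div (t : ℝ) : Monotone fun n => (digitApprox P n t : ℝ) / 2 ^ n := by
  refine monotone_nat_of_le_succ fun n => ?_
  have h : ((2 * digitApprox P n t : ℕ) : ℝ) ≤ digitApprox P (n + 1) t :=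
    Nat.cast_le.2 (digitApprox_succ_bounds n t).1
  rw [pow_succ, div_le_div_iff₀ (by positivity) (by positivity)]
  push_cast at h
  nlinarith [pow_pos (two_pos : (0 : ℝ) < 2) n]

lemma antitone_digitApprox_add_one_div (t : ℝ) :
    Antitone fun n => ((digitApprox P n t : ℝ) + 1) / 2 ^ n := by
  refine antitone_nat_of_succ_le fun n => ?_
  have h : (digitApprox P (n + 1) t : ℝ) ≤ ((2 * digitApprox P n t + 1 : ℕ) : ℝ) :=
    Nat.cast_le.2 (digitApprox_succ_bounds n t).2
  rw [pow_succ, div_le_div_iff₀ (by positivity) (by positivity)]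
  push_cast at h
  nlinarith [pow_pos (two_pos : (0 : ℝ) < 2) n]

lemma digitApprox_div_le (n k : ℕ) (t : ℝ) :
    (digitApprox P k t : ℝ) / 2 ^ k ≤ ((digitApprox P n t : ℝ) + 1) / 2 ^ n := by
  rcases le_total k n with h | h
  · refine (monotone_digitApprox_div t h).trans ?_
    dsimp only
    gcongr
    linarith
  · refine le_trans ?_ (antitone_digitApprox_add_one_div (P := P) t h)
    dsimp only
    gcongr
    linarith

lemma digitMap_le (n : ℕ) (t : ℝ) : digitMap P t ≤ ((digitApprox P n t : ℝ) + 1) / 2 ^ n :=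
  ciSup_le fun k => digitApprox_div_le n k t

lemma le_digitMap (n : ℕ) (t : ℝ) : (digitApprox P n t : ℝ) / 2 ^ n ≤ digitMap P t :=
  le_ciSup (f := fun k => (digitApprox P k t : ℝ) / 2 ^ k)
    ⟨_, by rintro _ ⟨k, rfl⟩; exact digitApprox_div_le 0 k t⟩ n

lemma digitApprox_eq_of_gap {a b : ℕ} (hab : a ≤ b) (h : ∀ i, a ≤ i → i < b → ¬ P i) (t : ℝ) :
    (digitApprox P b t : ℝ) / 2 ^ b = (digitApprox P a t : ℝ) / 2 ^ a := by
  induction b, hab using Nat.le_induction with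
  | base => rfl
  | succ b hb ih =>
    rw [← ih fun i hi hib => h i hi (by omega), digitApprox_succ_of_not (h b hb (by omega)),
      pow_succ]
    push_cast
    field_simp

/-- All digits in the gap are zero, so the truncation at `a` is already the truncation at `b`. This
yields the closeness to dyadic rationals. -/
lemma digitMap_sub_le_of_gap {a b : ℕ} (hab : a ≤ b) (h : ∀ i, a ≤ i → i < b → ¬ P i) (t : ℝ) :
    digitMap P t - (digitApprox P a t : ℝ) / 2 ^ a ≤ ((2 : ℝ) ^ b)⁻¹ := by
  have := digitMap_le (P := P) b t
  rw [add_div, digitApprox_eq_of_gap hab h, one_div] at this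
  linarith

/-- Otherwise the integers formed by the first `q` digits differ by at least `2`, and so do their
images. One unit may be lost to the tail of `digitMap P t`; the other still separates the values by
`2 ^ (-n)`. -/
lemma sub_lt_of_digitMap_sub_lt {n : ℕ} {t u : ℝ} (ht : 0 ≤ t)
    (h : digitMap P u - digitMap P t < ((2 : ℝ) ^ n)⁻¹) :
    u - t < 2 * ((2 : ℝ) ^ (Nat.count P n))⁻¹ := by
  by_contra! hcon
  set q := Nat.count P n
  have hq : (0 : ℝ) < 2 ^ q := by positivity
  have hfl : ⌊(2 : ℝ) ^ q * t⌋₊ + 2 ≤ ⌊(2 : ℝ) ^ q * u⌋₊ := by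
    apply Nat.le_floor
    push_cast
    have h1 := Nat.floor_le (mul_nonneg hq.le ht)
    have h2 := mul_le_mul_of_nonneg_left hcon hq.le
    have e : (2 : ℝ) ^ q * (2 * ((2 : ℝ) ^ q)⁻¹) = 2 := by field_simp
    rw [e] at h2
    linarith
  have hap : digitApprox P n t + 2 ≤ digitApprox P n u := by
    have h1 := insertDigits_strictMono P n (Nat.lt_succ_self ⌊(2 : ℝ) ^ q * t⌋₊)
    have h2 := insertDigits_strictMono P n (Nat.lt_succ_self (⌊(2 : ℝ) ^ q * t⌋₊ + 1))
    have h3 := (insertDigits_strictMono P n).monotone hfl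
    simp only [digitApprox]
    simp only [Nat.succ_eq_add_one] at h1 h2
    change _ ≤ insertDigits P n ⌊(2 : ℝ) ^ q * u⌋₊
    change insertDigits P n ⌊(2 : ℝ) ^ q * t⌋₊ + 2 ≤ _
    rw [show ⌊(2 : ℝ) ^ q * t⌋₊ + 1 + 1 = ⌊(2 : ℝ) ^ q * t⌋₊ + 2 by ring] at h2
    omega
  have hap' : (digitApprox P n t : ℝ) + 2 ≤ digitApprox P n u := by exact_mod_cast hap
  have h1 := digitMap_le (P := P) n t
  have h2 := le_digitMap (P := P) n u
  have h3 : ((digitApprox P n t : ℝ) + 2) / 2 ^ n ≤ (digitApprox P n u : ℝ) / 2 ^ n := by gcongr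
  have h4 : ((digitApprox P n t : ℝ) + 2) / 2 ^ n =
      ((digitApprox P n t : ℝ) + 1) / 2 ^ n + ((2 : ℝ) ^ n)⁻¹ := by ring
  linarith

lemma monotone_digitMap : Monotone (digitMap P) := by
  intro t u htu
  refine ciSup_le fun n => le_trans ?_ (le_digitMap n u)
  have : digitApprox P n t ≤ digitApprox P n u :=
    (insertDigits_strictMono P n).monotone (Nat.floor_mono (by gcongr))
  gcongr

/-- If the digit positions satisfying `P` have density at least `s`, the inverse of `digitMap P` is
Hölder continuous of exponent `s`. -/
lemma exists_abs_sub_le_abs_digitMap_sub_rpow {s C : ℝ} (hs : 0 < s)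
    (hC : ∀ n : ℕ, s * n - C ≤ Nat.count P n) :
    ∃ K : ℝ, ∀ t u : ℝ, 0 ≤ t → 0 ≤ u → |digitMap P u - digitMap P t| ≤ 1 / 2 →
      |u - t| ≤ K * |digitMap P u - digitMap P t| ^ s := by
  refine ⟨2 * 2 ^ C * 2 ^ s, ?_⟩
  have hq : ∀ n : ℕ, ((2 : ℝ) ^ (Nat.count P n))⁻¹ ≤ 2 ^ C * (((2 : ℝ) ^ n)⁻¹) ^ s := by
    intro n
    rw [← Real.rpow_natCast, ← Real.rpow_natCast, ← Real.rpow_neg (by norm_num),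
      ← Real.rpow_neg (by norm_num), ← Real.rpow_mul (by norm_num), ← Real.rpow_add (by norm_num)]
    apply Real.rpow_le_rpow_of_exponent_le (by norm_num)
    have := hC n
    linarith
  have main : ∀ t u : ℝ, 0 ≤ t → t ≤ u → |digitMap P u - digitMap P t| ≤ 1 / 2 →
      |u - t| ≤ 2 * 2 ^ C * 2 ^ s * |digitMap P u - digitMap P t| ^ s := by
    intro t u ht htu hd
    have hmono := monotone_digitMap (P := P) htu
    rw [abs_of_nonneg (sub_nonneg.2 htu)]
    rw [abs_of_nonneg (sub_nonneg.2 hmono)] at hd ⊢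
    set d := digitMap P u - digitMap P t with hdd
    have hd0 : 0 ≤ d := sub_nonneg.2 hmono
    have hsm : ∀ n : ℕ, d < ((2 : ℝ) ^ n)⁻¹ → u - t ≤ 2 * 2 ^ C * (((2 : ℝ) ^ n)⁻¹) ^ s := by
      intro n hn
      have := sub_lt_of_digitMap_sub_lt ht hn
      nlinarith [hq n]
    rcases hd0.eq_or_lt with h0 | hpos
    · rw [← h0, Real.zero_rpow hs.ne', mul_zero]
      have ht0 : Tendsto (fun n : ℕ => 2 * (2 : ℝ) ^ C * (((2 : ℝ) ^ n)⁻¹) ^ s) atTop (nhds 0) := by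
        have h1 : Tendsto (fun n : ℕ => ((2 : ℝ) ^ n)⁻¹) atTop (nhds 0) := by
          exact tendsto_inv_atTop_zero.comp (tendsto_pow_atTop_atTop_of_one_lt
            (one_lt_two : (1 : ℝ) < 2))
        have h2 := (h1.rpow_const (p := s) (Or.inr hs.le)).const_mul (2 * (2 : ℝ) ^ C)
        simpa [Real.zero_rpow hs.ne'] using h2
      exact ge_of_tendsto' ht0 fun n => hsm n (by rw [← h0]; positivity)
    · have hex : ∃ n : ℕ, ((2 : ℝ) ^ n)⁻¹ ≤ d := by
        obtain ⟨n, hn⟩ := exists_pow_lt_of_lt_one hpos (by norm_num : (2 : ℝ)⁻¹ < 1)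
        exact ⟨n, by rw [← inv_pow]; exact hn.le⟩
      classical
      have h1 := Nat.find_spec hex
      have h2 := fun m => Nat.find_min hex (m := m)
      set k := Nat.find hex
      -- The restriction to differences at most `1 / 2` excludes scale `0`, so a preceding scale
      -- exists.
      have hk0 : k ≠ 0 := by
        intro h0
        rw [h0] at h1
        norm_num at h1
        linarith
      obtain ⟨n, hn⟩ := Nat.exists_eq_succ_of_ne_zero hk0
      have h3 := hsm n (not_le.1 (h2 n (by omega)))
      refine h3.trans ?_
      rw [hn, pow_succ, mul_inv] at h1
      have h4 : ((2 : ℝ) ^ n)⁻¹ ≤ 2 * d := by linarith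
      calc 2 * (2 : ℝ) ^ C * (((2 : ℝ) ^ n)⁻¹) ^ s ≤ 2 * (2 : ℝ) ^ C * (2 * d) ^ s := by
            gcongr
        _ = _ := by rw [Real.mul_rpow (by norm_num) hd0]; ring
  intro t u ht hu hd
  rcases le_total t u with h | h
  · exact main t u ht h hd
  · rw [abs_sub_comm u t, abs_sub_comm (digitMap P u)]
    rw [abs_sub_comm] at hd
    exact main u t hu h hd

lemma digitMap_nonneg (t : ℝ) : 0 ≤ digitMap P t := le_trans (by positivity) (le_digitMap 0 t)

lemma digitMap_le_half (h0 : ¬ P 0) {t : ℝ} (ht : t < 1) : digitMap P t ≤ 1 / 2 := by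
  have h := digitMap_le (P := P) 1 t
  rw [digitApprox_succ_of_not h0] at h
  have : digitApprox P 0 t = 0 := by
    simp only [digitApprox, insertDigits, Nat.count_zero, pow_zero, one_mul]
    exact Nat.floor_eq_zero.2 ht
  simpa [this] using h

end InsertDigits

/-! ### The Cantor-type map near dyadic rationals -/

/-- The positions lying outside of all the gaps `[N i, m i)`, except the position `0`. -/
def OutsideGaps (N m : ℕ → ℕ) (n : ℕ) : Prop := n ≠ 0 ∧ ∀ i, ¬ (N i ≤ n ∧ n < m i)

lemma Nat.add_sub_le_count {P : ℕ → Prop} [DecidablePred P] {a b : ℕ} (hab : a ≤ b)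
    (h : ∀ i, a ≤ i → i < b → P i) : Nat.count P a + (b - a) ≤ Nat.count P b := by
  induction b, hab using Nat.le_induction with
  | base => simp
  | succ b hb ih =>
    have := ih fun i hi hib => h i hi (by omega)
    rw [Nat.count_succ, if_pos (h b hb (by omega))]
    omega

/-- The density is lowest at the end `m i` of a gap. Up to there at least `N i - m (i - 1)`
positions are free; `N i` is at least `τ * m i`, and sparseness makes `m (i - 1)` negligible. -/
lemma exists_le_count_outsideGaps {N m : ℕ → ℕ} [DecidablePred (OutsideGaps N m)] {τ s : ℝ}
    (hτ1 : τ ≤ 1) (hsτ : s < τ) (hN0 : 1 ≤ N 0) (hNm : ∀ i, N i ≤ m i)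
    (hmτ : ∀ i, τ * m i ≤ N i) (hsparse : ∀ i, (i + 1) * m i ≤ N (i + 1)) (hs : 0 ≤ s) :
    ∃ C : ℝ, ∀ n : ℕ, s * n - C ≤ Nat.count (OutsideGaps N m) n := by
  have hmN : ∀ i, m i ≤ N (i + 1) := fun i => le_trans (by nlinarith [hNm i]) (hsparse i)
  have hNmono : Monotone N := monotone_nat_of_le_succ fun i => (hNm i).trans (hmN i)
  have hmmono : Monotone m := monotone_nat_of_le_succ fun i => (hmN i).trans (hNm _)
  have hN1 : ∀ i, 1 ≤ N i := fun i => hN0.trans (hNmono (Nat.zero_le i))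
  obtain ⟨i₀, hi₀⟩ := exists_nat_one_div_lt (sub_pos.2 hsτ)
  refine ⟨s * N (i₀ + 1), fun n => ?_⟩
  rcases lt_or_ge n (N (i₀ + 1)) with hn | hn
  · have : s * n ≤ s * N (i₀ + 1) := by gcongr
    have h0 : (0 : ℝ) ≤ Nat.count (OutsideGaps N m) n := by positivity
    linarith
  have hex : ∃ i, n < N (i + 1) := by
    refine ⟨n, lt_of_lt_of_le (Nat.lt_succ_self n) (le_trans ?_ (hsparse n))⟩
    have := (hN1 n).trans (hNm n)
    nlinarith
  classical
  have h1 := Nat.find_spec hex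
  have h2 := fun j => Nat.find_min hex (m := j)
  set i := Nat.find hex
  have hi : i₀ + 1 ≤ i := by
    by_contra! hcon
    have := hNmono (show i + 1 ≤ i₀ + 1 by omega)
    omega
  obtain ⟨j, hj⟩ : ∃ j, i = j + 1 := ⟨i - 1, by omega⟩
  have hNin : N i ≤ n := by
    have := h2 j (by omega)
    rw [hj]; omega
  have hfree : ∀ l k, m l ≤ k → k < N (l + 1) → OutsideGaps N m k := by
    intro l k hk1 hk2
    refine ⟨?_, fun l' hl' => ?_⟩
    · have := (hN1 l).trans (hNm l); omega
    · rcases le_or_gt l' l with h | h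
      · have := hmmono h; omega
      · have := hNmono (show l + 1 ≤ l' by omega); omega
  have hc1 : N i - m j ≤ Nat.count (OutsideGaps N m) (N i) := by
    have := Nat.add_sub_le_count (hmN j) (hfree j)
    rw [hj]; omega
  have hc2 : N i - m j + (n - m i) ≤ Nat.count (OutsideGaps N m) n := by
    rcases le_total n (m i) with h | h
    · have := Nat.count_monotone (OutsideGaps N m) hNin
      omega
    · have h3 := Nat.add_sub_le_count h fun k hk1 hk2 => hfree i k hk1 (by omega)
      have := Nat.count_monotone (OutsideGaps N m) (hNm i)
      omega
  have hc3 : (N i : ℝ) + ((n : ℝ) - m i) ≤ Nat.count (OutsideGaps N m) n + m j ∧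
      (N i : ℝ) ≤ Nat.count (OutsideGaps N m) n + m j := by
    constructor
    · have : N i + n ≤ Nat.count (OutsideGaps N m) n + m j + m i := by omega
      have : (N i : ℝ) + n ≤ Nat.count (OutsideGaps N m) n + m j + m i := by exact_mod_cast this
      linarith
    · have : N i ≤ Nat.count (OutsideGaps N m) n + m j := by omega
      exact_mod_cast this
  have hmain : τ * n ≤ Nat.count (OutsideGaps N m) n + m j := by
    have h3 := hmτ i
    rcases le_total n (m i) with h | h
    · have h' : (n : ℝ) ≤ m i := by exact_mod_cast h
      by_cases hτ0 : 0 ≤ τ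
      · nlinarith [hc3.2]
      · linarith
    · have h' : (m i : ℝ) ≤ n := by exact_mod_cast h
      nlinarith [hc3.1]
  have hmj : (m j : ℝ) ≤ (τ - s) * n := by
    have h3 : ((j : ℝ) + 1) * m j ≤ n := by
      have := (hsparse j).trans (hj ▸ hNin)
      exact_mod_cast this
    have h4 : (1 : ℝ) / (j + 1) ≤ τ - s := by
      refine le_trans ?_ hi₀.le
      have : (i₀ : ℝ) ≤ j := by exact_mod_cast (show i₀ ≤ j by omega)
      gcongr
    rw [div_le_iff₀ (by positivity)] at h4
    have hm0 : (0 : ℝ) ≤ m j := by positivity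
    calc (m j : ℝ) ≤ (τ - s) * (j + 1) * m j := by nlinarith
      _ = (τ - s) * ((j + 1) * m j) := by ring
      _ ≤ _ := mul_le_mul_of_nonneg_left h3 (by linarith)
  have : (0 : ℝ) ≤ s * N (i₀ + 1) := by positivity
  linarith

/-- A Cantor-type map into the set of points which are `2 ^ (-m i)`-close to a dyadic rational of
denominator `2 ^ N i` for all `i`, with an inverse which is Hölder continuous of any
exponent `s < τ`. -/
theorem exists_map_near_dyadic {N m : ℕ → ℕ} {τ : ℝ} (hτ1 : τ ≤ 1) (hN0 : 1 ≤ N 0)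
    (hNm : ∀ i, N i ≤ m i) (hmτ : ∀ i, τ * m i ≤ N i)
    (hsparse : ∀ i, (i + 1) * m i ≤ N (i + 1)) :
    ∃ H : ℝ → UnitAddCircle,
      (∀ s : ℝ, 0 < s → s < τ → ∃ K : ℝ, ∀ t ∈ Set.Ico (0 : ℝ) 1, ∀ u ∈ Set.Ico (0 : ℝ) 1,
        dist t u ≤ K * dist (H t) (H u) ^ s) ∧
      ∀ i t, ∃ (k : ℕ) (δ : ℝ), H t = ((k / 2 ^ N i + δ : ℝ) : UnitAddCircle) ∧ 0 ≤ δ ∧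
        δ ≤ ((2 : ℝ) ^ m i)⁻¹ := by
  classical
  refine ⟨fun t => (digitMap (OutsideGaps N m) t : UnitAddCircle), fun s hs0 hsτ => ?_,
    fun i t => ?_⟩
  · obtain ⟨C, hC⟩ := exists_le_count_outsideGaps hτ1 hsτ hN0 hNm hmτ hsparse hs0.le
    obtain ⟨K, hK⟩ := exists_abs_sub_le_abs_digitMap_sub_rpow hs0 hC
    refine ⟨K, fun t ht u hu => ?_⟩
    -- A zero leading digit keeps all values in `[0, 1/2]`, where the circle distance is the
    -- distance on the line.
    have h0 : ¬ OutsideGaps N m 0 := fun h => h.1 rfl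
    have hd : |digitMap (OutsideGaps N m) t - digitMap (OutsideGaps N m) u| ≤ 1 / 2 := by
      have h1 := digitMap_le_half h0 ht.2
      have h2 := digitMap_le_half h0 hu.2
      have h3 := digitMap_nonneg (P := OutsideGaps N m) t
      have h4 := digitMap_nonneg (P := OutsideGaps N m) u
      rw [abs_le]; constructor <;> linarith
    rw [dist_eq_norm (_ : UnitAddCircle), ← AddCircle.coe_sub,
      (AddCircle.norm_coe_eq_abs_iff 1 one_ne_zero).2 (by simpa using hd)]
    exact hK u t hu.1 ht.1 hd
  · refine ⟨digitApprox (OutsideGaps N m) (N i) t, digitMap (OutsideGaps N m) t -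
      (digitApprox (OutsideGaps N m) (N i) t : ℝ) / 2 ^ N i, by rw [add_sub_cancel],
      sub_nonneg.2 (le_digitMap _ _), digitMap_sub_le_of_gap (hNm i) (fun k h1 h2 h => ?_) t⟩
    exact h.2 i ⟨h1, h2⟩

/-! ### Fourier coefficients and partial sums as functionals on `L¹` -/

/-- The `k`-th Fourier coefficient as a continuous linear functional on `L¹(𝕋)`. -/
noncomputable def fourierCoeffCLM (k : ℤ) : L1Circle →L[ℂ] ℂ :=
  LinearMap.mkContinuous
    { toFun := fun f => fourierCoeff (f : UnitAddCircle → ℂ) k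
      map_add' := fun f g => by
        rw [fourierCoeff_congr_ae (Lp.coeFn_add f g),
          fourierCoeff.add (L1.integrable_coeFn f) (L1.integrable_coeFn g)]
        rfl
      map_smul' := fun c f => by
        rw [fourierCoeff_congr_ae (Lp.coeFn_smul c f), fourierCoeff.const_smul]
        rfl } 1 fun f => by
    rw [one_mul, L1.norm_eq_integral_norm]
    refine (norm_integral_le_integral_norm _).trans (le_of_eq ?_)
    congr 1
    ext t
    rw [norm_smul, norm_fourier_apply, one_mul]

lemma fourierCoeffCLM_apply (k : ℤ) (f : L1Circle) :
    fourierCoeffCLM k f = fourierCoeff (f : UnitAddCircle → ℂ) k := rfl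

lemma norm_fourierCoeffCLM_apply_le (k : ℤ) (f : L1Circle) : ‖fourierCoeffCLM k f‖ ≤ ‖f‖ := by
  refine (ContinuousLinearMap.le_of_opNorm_le (fourierCoeffCLM k)
    (LinearMap.mkContinuous_norm_le _ zero_le_one _) f).trans_eq (one_mul _)

/-- Evaluation at `x` of the `n`-th partial sum of the Fourier series. -/
noncomputable def partialSumCLM (n : ℕ) (x : UnitAddCircle) : L1Circle →L[ℂ] ℂ :=
  ∑ k ∈ Finset.Icc (-(n : ℤ)) (n : ℤ), fourier k x • fourierCoeffCLM k

lemma partialSumCLM_apply (n : ℕ) (x : UnitAddCircle) (f : L1Circle) :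
    partialSumCLM n x f =
      ∑ k ∈ Finset.Icc (-(n : ℤ)) (n : ℤ), fourier k x * fourierCoeffCLM k f := by
  simp [partialSumCLM]

lemma fourierPartialSum_eq_partialSumCLM (n : ℕ) (x : UnitAddCircle) (f : L1Circle) :
    fourierPartialSum n (f : UnitAddCircle → ℂ) x = partialSumCLM n x f := by
  rw [partialSumCLM_apply]
  exact Finset.sum_congr rfl fun k _ => mul_comm _ _

lemma norm_partialSumCLM_apply_le (n : ℕ) (x : UnitAddCircle) (f : L1Circle) :
    ‖partialSumCLM n x f‖ ≤ (2 * n + 1) * ‖f‖ := by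
  rw [partialSumCLM_apply]
  refine (norm_sum_le_of_le _ fun k _ => ?_).trans (le_of_eq ?_) (b := ∑ k ∈ Finset.Icc (-(n : ℤ)) (n : ℤ), ‖f‖)
  · rw [norm_mul, norm_fourier_apply, one_mul]
    exact norm_fourierCoeffCLM_apply_le k f
  · simp only [Finset.sum_const, Int.card_Icc, nsmul_eq_mul]
    have : ((n : ℤ) + 1 - -(n : ℤ)).toNat = 2 * n + 1 := by omega
    rw [this]; push_cast; rfl

lemma norm_partialSumCLM_le_of_degree_le {N : ℕ} {h : L1Circle} {C : ℝ} (hC : 0 ≤ C)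
    (hdeg : ∀ k : ℤ, (N : ℤ) < |k| → fourierCoeffCLM k h = 0)
    (hcoef : ∀ k : ℤ, ‖fourierCoeffCLM k h‖ ≤ C) (n : ℕ) (x : UnitAddCircle) :
    ‖partialSumCLM n x h‖ ≤ (2 * N + 1) * C := by
  rw [partialSumCLM_apply]
  have hb : ∀ k ∈ Finset.Icc (-(n : ℤ)) (n : ℤ), ‖fourier k x * fourierCoeffCLM k h‖ ≤
      if k ∈ Finset.Icc (-(N : ℤ)) (N : ℤ) then C else 0 := by
    intro k _
    rw [norm_mul, norm_fourier_apply, one_mul]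
    split_ifs with hk
    · exact hcoef k
    · rw [hdeg k, norm_zero]
      rw [Finset.mem_Icc, ← abs_le] at hk
      exact not_le.1 hk
  refine (norm_sum_le_of_le _ hb).trans ?_
  rw [← Finset.sum_filter, Finset.sum_const, nsmul_eq_mul]
  gcongr
  calc ((Finset.filter (· ∈ Finset.Icc (-(N : ℤ)) (N : ℤ)) (Finset.Icc (-(n : ℤ)) n)).card : ℝ)
      ≤ ((Finset.Icc (-(N : ℤ)) (N : ℤ)).card : ℝ) := by
        gcongr
        intro k hk
        exact (Finset.mem_filter.1 hk).2
    _ = 2 * N + 1 := by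
        rw [Int.card_Icc]
        have : ((N : ℤ) + 1 - -(N : ℤ)).toNat = 2 * N + 1 := by omega
        rw [this]; push_cast; rfl

/-- Transferred from orthonormality in `L²`, since coefficients only see the class almost
everywhere. -/
lemma fourierCoeffCLM_fourierLp (j k : ℤ) :
    fourierCoeffCLM k (fourierLp 1 j) = if k = j then 1 else 0 := by
  have h2 : fourierCoeff (fourierLp (T := 1) 2 j : UnitAddCircle → ℂ) k = if k = j then 1 else 0 := by
    rw [← fourierBasis_repr, HilbertBasis.repr_apply_apply, coe_fourierBasis]
    exact orthonormal_iff_ite.1 orthonormal_fourier k j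
  rw [fourierCoeffCLM_apply, ← h2]
  exact congrFun (fourierCoeff_congr_ae
    ((coeFn_fourierLp 1 j).trans (coeFn_fourierLp 2 j).symm)) k

/-! ### Dilated Fejér kernels -/

/-- The Fejér kernel of order `L`, dilated by `q`, as a double sum. -/
noncomputable def dilatedFejer (q L : ℕ) : C(UnitAddCircle, ℂ) :=
  (L : ℂ)⁻¹ • ∑ p ∈ Finset.range L ×ˢ Finset.range L, fourier (((p.1 : ℤ) - p.2) * q)

/-- The dilated Fejér kernel as an element of `L¹(𝕋)`. -/
noncomputable def dilatedFejerL1 (q L : ℕ) : L1Circle :=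
  ContinuousMap.toLp (E := ℂ) 1 AddCircle.haarAddCircle ℂ (dilatedFejer q L)

/-- The Fourier coefficients of the dilated Fejér kernel. -/
noncomputable def fejerWeight (q L : ℕ) (k : ℤ) : ℝ :=
  ((Finset.range L ×ˢ Finset.range L).filter fun p => ((p.1 : ℤ) - p.2) * q = k).card / L

lemma fejerWeight_nonneg (q L : ℕ) (k : ℤ) : 0 ≤ fejerWeight q L k := by
  unfold fejerWeight; positivity

lemma fourierCoeffCLM_dilatedFejerL1 (q L : ℕ) (k : ℤ) :
    fourierCoeffCLM k (dilatedFejerL1 q L) = (fejerWeight q L k : ℂ) := by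
  rw [dilatedFejerL1, dilatedFejer, map_smul, map_sum, map_smul, map_sum]
  have : ∀ p ∈ Finset.range L ×ˢ Finset.range L,
      fourierCoeffCLM k (ContinuousMap.toLp (E := ℂ) 1 AddCircle.haarAddCircle ℂ
        (fourier (((p.1 : ℤ) - p.2) * q))) = if ((p.1 : ℤ) - p.2) * q = k then 1 else 0 := by
    intro p _
    refine (fourierCoeffCLM_fourierLp _ k).trans ?_
    simp only [eq_comm]
  rw [Finset.sum_congr rfl this, Finset.sum_ite, Finset.sum_const_zero, add_zero, Finset.sum_const,
    fejerWeight, smul_eq_mul, nsmul_eq_mul, mul_one]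
  push_cast
  rw [div_eq_inv_mul]

/-- There are at least `L - |j|` pairs with difference `j`, parametrized here by shifting `b` by the
positive and negative parts of `j`. -/
lemma half_le_fejerWeight {q L : ℕ} {j : ℤ} (hL : 0 < L) (hj : 2 * |j| ≤ L) :
    1 / 2 ≤ fejerWeight q L (j * q) := by
  have hcard : L - j.natAbs ≤ ((Finset.range L ×ˢ Finset.range L).filter
      fun p => ((p.1 : ℤ) - p.2) * q = j * q).card := by
    conv_lhs => rw [← Finset.card_range (L - j.natAbs)]
    refine Finset.card_le_card_of_injOn (fun b => (b + j.toNat, b + (-j).toNat)) ?_ ?_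
    · intro b hb
      simp only [Finset.coe_range, Set.mem_Iio] at hb
      simp only [Finset.coe_filter, Finset.mem_product, Finset.mem_range]
      refine ⟨⟨by omega, by omega⟩, ?_⟩
      congr 1
      push_cast
      omega
    · intro b _ b' _ hbb
      simp only [Prod.mk.injEq] at hbb
      omega
  rw [Int.abs_eq_natAbs] at hj
  rw [fejerWeight, div_le_div_iff₀ (by norm_num) (by exact_mod_cast hL), one_mul]
  have : L ≤ ((Finset.range L ×ˢ Finset.range L).filter
      fun p => ((p.1 : ℤ) - p.2) * q = j * q).card * 2 := by omega
  exact_mod_cast this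

/-- The squared modulus shows positivity, which turns the `L¹` norm into the zeroth coefficient. -/
lemma dilatedFejer_apply (q L : ℕ) (t : UnitAddCircle) :
    dilatedFejer q L t =
      (((L : ℝ)⁻¹ * ‖∑ a ∈ Finset.range L, fourier ((a : ℤ) * q) t‖ ^ 2 : ℝ) : ℂ) := by
  have h : ((‖∑ a ∈ Finset.range L, fourier ((a : ℤ) * q) t‖ ^ 2 : ℝ) : ℂ) =
      ∑ p ∈ Finset.range L ×ˢ Finset.range L, fourier (((p.1 : ℤ) - p.2) * q) t := by
    rw [Complex.ofReal_pow, ← Complex.mul_conj', map_sum, Finset.sum_mul_sum, Finset.sum_product]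
    refine Finset.sum_congr rfl fun a _ => Finset.sum_congr rfl fun b _ => ?_
    rw [← fourier_neg, ← fourier_add]
    congr 2
    ring
  rw [Complex.ofReal_mul, h, dilatedFejer]
  simp

lemma norm_dilatedFejerL1 {q L : ℕ} (hq : 0 < q) (hL : 0 < L) : ‖dilatedFejerL1 q L‖ = 1 := by
  have hae := ContinuousMap.coeFn_toLp (p := 1) (E := ℂ) (𝕜 := ℂ)
    (AddCircle.haarAddCircle : Measure UnitAddCircle) (dilatedFejer q L)
  have h1 : (‖dilatedFejerL1 q L‖ : ℂ) = fourierCoeffCLM 0 (dilatedFejerL1 q L) := by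
    rw [L1.norm_eq_integral_norm, ← integral_complex_ofReal, fourierCoeffCLM_apply, fourierCoeff]
    refine integral_congr_ae ?_
    filter_upwards [hae] with t ht
    have ht' : (dilatedFejerL1 q L : UnitAddCircle → ℂ) t = dilatedFejer q L t := ht
    rw [ht', dilatedFejer_apply, Complex.norm_real, neg_zero, fourier_zero, one_smul,
      Real.norm_of_nonneg (by positivity)]
  rw [fourierCoeffCLM_dilatedFejerL1] at h1
  rw [Complex.ofReal_injective h1, fejerWeight]
  have : (Finset.range L ×ˢ Finset.range L).filter (fun p => ((p.1 : ℤ) - p.2) * q = 0) =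
      (Finset.range L).image fun a => (a, a) := by
    ext ⟨a, b⟩
    have hq' : (q : ℤ) ≠ 0 := by exact_mod_cast hq.ne'
    simp only [Finset.mem_filter, Finset.mem_product, Finset.mem_range, Finset.mem_image,
      mul_eq_zero, hq', or_false, Prod.mk.injEq]
    constructor
    · rintro ⟨⟨ha, hb⟩, hab⟩
      exact ⟨a, ha, rfl, by omega⟩
    · rintro ⟨c, hc, rfl, rfl⟩
      exact ⟨⟨hc, hc⟩, by simp⟩
  rw [this, Finset.card_image_of_injective _ fun a b h => (Prod.mk.inj h).1, Finset.card_range]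
  field_simp

lemma fourier_re_coe (k : ℤ) (y : ℝ) :
    (fourier k (y : UnitAddCircle)).re = Real.cos (2 * Real.pi * (k * y)) := by
  rw [fourier_coe_apply]
  have : (2 * Real.pi * Complex.I * k * y / (1 : ℝ) : ℂ) =
      ((2 * Real.pi * (k * y) : ℝ) : ℂ) * Complex.I := by push_cast; ring
  rw [this, Complex.exp_ofReal_mul_I_re]

lemma fejerWeight_eq_zero {q L : ℕ} {k : ℤ} (h : ¬ (q : ℤ) ∣ k) : fejerWeight q L k = 0 := by
  rw [fejerWeight, Finset.card_eq_zero.2, Nat.cast_zero, zero_div]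
  refine Finset.filter_eq_empty_iff.2 fun p _ hp => h ?_
  rw [← hp]
  exact dvd_mul_left _ _

lemma half_le_cos {θ : ℝ} (h : |θ| ≤ Real.pi / 4) : 1 / 2 ≤ Real.cos θ := by
  have h1 := Real.one_sub_sq_div_two_le_cos (x := θ)
  have h2 : θ ^ 2 ≤ (Real.pi / 4) ^ 2 := sq_le_sq' (abs_le.1 h).1 (abs_le.1 h).2
  have := Real.pi_lt_d2
  have := Real.pi_pos
  nlinarith

/-- Only frequencies `j * q` occur. At `a / q + δ` their phases are `j * q * δ` modulo `1`, at most
`1 / 8`, so every term is nonnegative. Each `0 ≤ j < M` contributes weight `1 / 2` times cosine `1 /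
2`. -/
lemma le_re_partialSumCLM_dilatedFejerL1 {q L M : ℕ} (hL : 0 < L) (hML : 2 * M ≤ L)
    {a : ℤ} {δ : ℝ} (hq : 0 < q) (hδ : |M * q * δ| ≤ 1 / 8) :
    (M : ℝ) / 4 ≤ (partialSumCLM (M * q) ((a / q + δ : ℝ) : UnitAddCircle)
      (dilatedFejerL1 q L)).re := by
  rw [partialSumCLM_apply, Complex.re_sum]
  have hterm : ∀ k, (fourier k ((a / q + δ : ℝ) : UnitAddCircle) *
      fourierCoeffCLM k (dilatedFejerL1 q L)).re =
        fejerWeight q L k * (fourier k ((a / q + δ : ℝ) : UnitAddCircle)).re := by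
    intro k
    rw [fourierCoeffCLM_dilatedFejerL1, mul_comm, Complex.re_ofReal_mul]
  simp_rw [hterm]
  have hq' : (q : ℝ) ≠ 0 := by positivity
  have hcos : ∀ j : ℤ, |j| ≤ M →
      1 / 2 ≤ (fourier (j * q) ((a / q + δ : ℝ) : UnitAddCircle)).re := by
    intro j hj
    rw [fourier_re_coe]
    have e : 2 * Real.pi * (((j * q : ℤ) : ℝ) * (a / q + δ)) =
        2 * Real.pi * (j * q * δ) + ((j * a : ℤ) : ℝ) * (2 * Real.pi) := by
      push_cast
      field_simp
      ring
    rw [e, Real.cos_add_int_mul_two_pi]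
    apply half_le_cos
    have hj' : |(j : ℝ)| ≤ M := by exact_mod_cast hj
    have : |(j : ℝ) * q * δ| ≤ 1 / 8 := by
      refine le_trans ?_ hδ
      rw [abs_mul, abs_mul, abs_mul (_ * _), abs_mul, Nat.abs_cast M]
      gcongr
    rw [abs_mul, abs_of_pos Real.two_pi_pos]
    nlinarith [Real.pi_pos]
  have hnn : ∀ k ∈ Finset.Icc (-((M * q : ℕ) : ℤ)) ((M * q : ℕ) : ℤ),
      0 ≤ fejerWeight q L k * (fourier k ((a / q + δ : ℝ) : UnitAddCircle)).re := by
    intro k hk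
    by_cases hd : (q : ℤ) ∣ k
    · obtain ⟨j, rfl⟩ := hd
      rw [mul_comm (q : ℤ) j] at hk ⊢
      refine mul_nonneg (fejerWeight_nonneg _ _ _) (le_trans (by norm_num) (hcos j ?_))
      rw [Finset.mem_Icc, ← abs_le, abs_mul, Nat.abs_cast] at hk
      push_cast at hk
      exact le_of_mul_le_mul_right hk (by exact_mod_cast hq)
    · rw [fejerWeight_eq_zero hd, zero_mul]
  have hsub : (Finset.range M).image (fun j : ℕ => (j : ℤ) * q) ⊆
      Finset.Icc (-((M * q : ℕ) : ℤ)) ((M * q : ℕ) : ℤ) := by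
    intro k hk
    obtain ⟨j, hj, rfl⟩ := Finset.mem_image.1 hk
    rw [Finset.mem_range] at hj
    rw [Finset.mem_Icc]
    have : j * q ≤ M * q := Nat.mul_le_mul_right _ hj.le
    have h' : (j : ℤ) * q ≤ ((M * q : ℕ) : ℤ) := by exact_mod_cast this
    exact ⟨le_trans (neg_nonpos.2 (by positivity)) (by positivity : (0 : ℤ) ≤ j * q), h'⟩
  refine le_trans ?_ (Finset.sum_le_sum_of_subset_of_nonneg hsub fun k hk _ => hnn k hk)
  rw [Finset.sum_image]
  · calc (M : ℝ) / 4 = ∑ j ∈ Finset.range M, (1 / 2 : ℝ) * (1 / 2) := by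
          simp only [Finset.sum_const, Finset.card_range, nsmul_eq_mul]; ring
      _ ≤ _ := by
        refine Finset.sum_le_sum fun j hj => ?_
        rw [Finset.mem_range] at hj
        have hj1 : |(j : ℤ)| ≤ M := by rw [Nat.abs_cast]; exact_mod_cast hj.le
        exact mul_le_mul (half_le_fejerWeight hL (by omega)) (hcos j hj1) (by norm_num)
          (fejerWeight_nonneg _ _ _)
  · intro i _ j _ hij
    have hq'' : (q : ℤ) ≠ 0 := by exact_mod_cast hq.ne'
    have := mul_right_cancel₀ hq'' hij
    exact_mod_cast this

/-! ### Spikes and their genericity -/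

/-- The spike added at level `N`. -/
noncomputable def spike (N : ℕ) : L1Circle := dilatedFejerL1 (2 ^ N) (2 ^ (N ^ 2 + 1))

lemma norm_spike (N : ℕ) : ‖spike N‖ = 1 := norm_dilatedFejerL1 (by positivity) (by positivity)

/-- The function `f` is very close to a trigonometric polynomial of degree at most `N` plus a small
multiple of the spike of level `N`. -/
def HasSpikeAt (f : L1Circle) (N : ℕ) : Prop :=
  ∃ h : L1Circle, (∀ k : ℤ, (N : ℤ) < |k| → fourierCoeffCLM k h = 0) ∧
    (∀ k : ℤ, ‖fourierCoeffCLM k h‖ ≤ N) ∧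
    ‖f - (h + (N : ℂ)⁻¹ • spike N)‖ < (1 / 2) ^ (N ^ 2 + 3)

lemma isOpen_setOf_hasSpikeAt (N : ℕ) : IsOpen {f | HasSpikeAt f N} := by
  have : {f | HasSpikeAt f N} = ⋃ h ∈ {h : L1Circle | (∀ k : ℤ, (N : ℤ) < |k| →
      fourierCoeffCLM k h = 0) ∧ ∀ k : ℤ, ‖fourierCoeffCLM k h‖ ≤ N},
      Metric.ball (h + (N : ℂ)⁻¹ • spike N) ((1 / 2) ^ (N ^ 2 + 3)) := by
    ext f
    simp only [HasSpikeAt, Set.mem_iUnion, Metric.mem_ball, dist_eq_norm, exists_prop]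
    exact exists_congr fun h => (and_assoc (c := _ < _)).symm
  rw [this]
  exact isOpen_biUnion fun h _ => Metric.isOpen_ball

lemma eventually_fourierCoeffCLM_eq_zero {h : L1Circle}
    (hh : h ∈ Submodule.span ℂ (Set.range (fourierLp (T := 1) 1))) :
    ∀ᶠ N : ℕ in atTop, ∀ k : ℤ, (N : ℤ) < |k| → fourierCoeffCLM k h = 0 := by
  induction hh using Submodule.span_induction with
  | mem x hx =>
    obtain ⟨j, rfl⟩ := hx
    filter_upwards [eventually_ge_atTop j.natAbs] with N hN k hk
    rw [fourierCoeffCLM_fourierLp, if_neg]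
    rintro rfl
    rw [Int.abs_eq_natAbs] at hk
    omega
  | zero => simp
  | add x y _ _ hx hy =>
    filter_upwards [hx, hy] with N h1 h2 k hk
    rw [map_add, h1 k hk, h2 k hk, add_zero]
  | smul c x _ hx =>
    filter_upwards [hx] with N h1 k hk
    rw [map_smul, h1 k hk, smul_zero]

/-- Trigonometric polynomials are dense. Any one of them meets the degree and coefficient bounds
once `N` is large, and adding the spike moves it by only `1 / N`. -/
lemma dense_setOf_exists_hasSpikeAt (K : ℕ) : Dense {f | ∃ N ≥ K, HasSpikeAt f N} := by
  rw [Metric.dense_iff]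
  intro f r hr
  have hd : f ∈ closure (Submodule.span ℂ (Set.range (fourierLp (T := 1) 1)) : Set L1Circle) := by
    rw [← Submodule.topologicalClosure_coe, span_fourierLp_closure_eq_top ENNReal.one_ne_top]
    trivial
  obtain ⟨h, hh, hfh⟩ := Metric.mem_closure_iff.1 hd (r / 2) (half_pos hr)
  have h1 : Tendsto (fun N : ℕ => ((N : ℝ))⁻¹) atTop (nhds 0) := tendsto_inv_atTop_nhds_zero_nat
  obtain ⟨N, hN1, hN2, hN3, hN4⟩ := ((eventually_fourierCoeffCLM_eq_zero hh).and
    ((eventually_ge_atTop K).and ((h1.eventually_lt_const (half_pos hr)).and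
      (tendsto_natCast_atTop_atTop.eventually_ge_atTop ‖h‖)))).exists
  refine ⟨h + (N : ℂ)⁻¹ • spike N, ?_, N, hN2, h, hN1, fun k => ?_, ?_⟩
  · rw [Metric.mem_ball, dist_eq_norm]
    have e : h + (N : ℂ)⁻¹ • spike N - f = (h - f) + (N : ℂ)⁻¹ • spike N := by abel
    rw [e]
    refine (norm_add_le _ _).trans_lt ?_
    rw [norm_smul, norm_spike, norm_inv, Complex.norm_natCast, mul_one]
    rw [dist_comm, dist_eq_norm] at hfh
    linarith
  · exact (norm_fourierCoeffCLM_apply_le k h).trans hN4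
  · rw [sub_self, norm_zero]; positivity

/-- Quasi-all functions have spikes at infinitely many levels. -/
theorem eventually_residual_frequently_hasSpikeAt :
    ∀ᶠ f : L1Circle in residual L1Circle, ∃ᶠ N : ℕ in atTop, HasSpikeAt f N := by
  have h : ∀ K : ℕ, ∀ᶠ f : L1Circle in residual L1Circle, ∃ N ≥ K, HasSpikeAt f N := by
    intro K
    refine residual_of_dense_open ?_ (dense_setOf_exists_hasSpikeAt K)
    have : {f | ∃ N ≥ K, HasSpikeAt f N} = ⋃ N ∈ Set.Ici K, {f | HasSpikeAt f N} := by
      ext f; simp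
    change IsOpen {f | ∃ N ≥ K, HasSpikeAt f N}
    rw [this]
    exact isOpen_biUnion fun N _ => isOpen_setOf_hasSpikeAt N
  filter_upwards [eventually_countable_forall.2 h] with f hf
  exact frequently_atTop.2 hf

/-- Near the dyadic rationals of denominator `2 ^ N`, a spike of level `N` makes the partial sums
large. -/
lemma HasSpikeAt.le_norm_fourierPartialSum {f : L1Circle} {N m : ℕ} (hf : HasSpikeAt f N)
    (hN : 1 ≤ N) (hm1 : N + 3 ≤ m) (hm2 : m ≤ N ^ 2) {a : ℕ} {δ : ℝ} (hδ0 : 0 ≤ δ)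
    (hδ : δ ≤ ((2 : ℝ) ^ m)⁻¹) :
    (2 : ℝ) ^ (m - 3 - N) / (4 * N) - ((2 * N + 1) * N + 1) ≤
      ‖fourierPartialSum (2 ^ (m - 3)) (f : UnitAddCircle → ℂ)
        ((a / 2 ^ N + δ : ℝ) : UnitAddCircle)‖ := by
  obtain ⟨h, hdeg, hcoef, hclose⟩ := hf
  set x := ((a / 2 ^ N + δ : ℝ) : UnitAddCircle) with hx
  have hn : 2 ^ (m - 3) = 2 ^ (m - 3 - N) * 2 ^ N := by
    rw [← pow_add]; congr 1; omega
  have hB : (2 : ℝ) ^ (m - 3 - N) / 4 ≤ ‖partialSumCLM (2 ^ (m - 3)) x (spike N)‖ := by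
    refine le_trans ?_ (Complex.re_le_norm _)
    -- The order `2 ^ (N ^ 2 + 1)` of the spike is large enough for every `m ≤ N ^ 2`, hence for
    -- every ratio `m / N` once `N` is large.
    have hML : 2 * 2 ^ (m - 3 - N) ≤ 2 ^ (N ^ 2 + 1) := by
      rw [← pow_succ']; exact Nat.pow_le_pow_right two_pos (by omega)
    have hsmall : |((2 ^ (m - 3 - N) : ℕ) : ℝ) * ((2 ^ N : ℕ) : ℝ) * δ| ≤ 1 / 8 := by
      rw [← Nat.cast_mul, ← hn, abs_of_nonneg (by positivity)]
      push_cast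
      calc (2 : ℝ) ^ (m - 3) * δ ≤ 2 ^ (m - 3) * ((2 : ℝ) ^ m)⁻¹ := by gcongr
        _ = 1 / 8 := by
          obtain ⟨l, rfl⟩ : ∃ l, m = l + 3 := ⟨m - 3, by omega⟩
          rw [Nat.add_sub_cancel, pow_add]
          field_simp
          norm_num
    have := le_re_partialSumCLM_dilatedFejerL1 (q := 2 ^ N) (a := (a : ℤ))
      (L := 2 ^ (N ^ 2 + 1)) (by positivity) hML (by positivity) hsmall
    rw [← hn] at this
    push_cast at this
    exact this
  have hh := norm_partialSumCLM_le_of_degree_le (Nat.cast_nonneg N) hdeg hcoef (2 ^ (m - 3)) x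
  have hr : ‖partialSumCLM (2 ^ (m - 3)) x (f - (h + (N : ℂ)⁻¹ • spike N))‖ ≤ 1 := by
    refine (norm_partialSumCLM_apply_le _ _ _).trans ?_
    have hpow : (2 : ℝ) ^ (m - 3) ≤ 2 ^ (N ^ 2) :=
      pow_le_pow_right₀ (by norm_num) (by omega)
    have h1 : (1 : ℝ) ≤ 2 ^ (N ^ 2) := one_le_pow₀ (by norm_num)
    calc _ ≤ (4 * (2 : ℝ) ^ (N ^ 2)) * (1 / 2) ^ (N ^ 2 + 3) := by
          gcongr
          push_cast
          linarith
      _ = 1 / 2 := by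
          rw [pow_add, one_div, inv_pow]
          field_simp
          norm_num
      _ ≤ 1 := by norm_num
  rw [fourierPartialSum_eq_partialSumCLM]
  have e : partialSumCLM (2 ^ (m - 3)) x f = (N : ℂ)⁻¹ * partialSumCLM (2 ^ (m - 3)) x (spike N) -
      (-partialSumCLM (2 ^ (m - 3)) x h -
        partialSumCLM (2 ^ (m - 3)) x (f - (h + (N : ℂ)⁻¹ • spike N))) := by
    rw [map_sub, map_add, map_smul, smul_eq_mul]; ring
  rw [e]
  refine le_trans ?_ (norm_sub_norm_le _ _)
  have h2 := norm_sub_le (-partialSumCLM (2 ^ (m - 3)) x h)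
    (partialSumCLM (2 ^ (m - 3)) x (f - (h + (N : ℂ)⁻¹ • spike N)))
  rw [norm_neg] at h2
  have h3 : (2 : ℝ) ^ (m - 3 - N) / (4 * N) ≤
      ‖(N : ℂ)⁻¹ * partialSumCLM (2 ^ (m - 3)) x (spike N)‖ := by
    rw [norm_mul, norm_inv, Complex.norm_natCast, ← div_div, div_eq_inv_mul _ (N : ℝ)]
    gcongr
  linarith

/-- A spike of level `N` contributes to one of the frequencies `2 ^ N` and `2 ^ (N + 1)` at every
point. -/
lemma HasSpikeAt.exists_le_norm_fourierPartialSum {f : L1Circle} {N : ℕ} (hf : HasSpikeAt f N)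
    (hN : 1 ≤ N) (x : UnitAddCircle) :
    ∃ n : ℕ, 2 ^ (N - 1) ≤ n ∧ 1 / (8 * N) ≤ ‖fourierPartialSum n (f : UnitAddCircle → ℂ) x‖ := by
  obtain ⟨h, hdeg, hcoef, hclose⟩ := hf
  have hN0 : (0 : ℝ) < N := by exact_mod_cast hN
  set r := f - (h + (N : ℂ)⁻¹ • spike N) with hr
  have hfr : f = h + (N : ℂ)⁻¹ • spike N + r := by rw [hr]; abel
  have hrle : ‖r‖ ≤ 1 / (8 * N) := by
    refine hclose.le.trans ?_
    rw [one_div, inv_pow, ← one_div]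
    apply one_div_le_one_div_of_le (by positivity)
    have h1 : N < 2 ^ N := Nat.lt_two_pow_self
    have h2 : 2 ^ N ≤ 2 ^ (N ^ 2) := Nat.pow_le_pow_right two_pos (by nlinarith)
    have h3 : (N : ℝ) ≤ 2 ^ (N ^ 2) := by exact_mod_cast h1.le.trans h2
    rw [pow_add]
    linarith
  -- If `|cos θ| < 1 / 2`, then `cos (2 θ) = 2 cos² θ - 1 < -1 / 2`.
  obtain ⟨j, hj1, hj2, hcos⟩ : ∃ j : ℕ, 1 ≤ j ∧ j ≤ 2 ∧
      1 / 2 ≤ |(fourier ((j : ℤ) * (2 ^ N : ℕ)) x).re| := by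
    obtain ⟨y, -, rfl⟩ := UnitAddCircle.exists_coe_eq x
    set c := Real.cos (2 * Real.pi * ((2 ^ N : ℕ) * y)) with hc
    by_cases hc2 : 1 / 2 ≤ |c|
    · refine ⟨1, le_rfl, by norm_num, ?_⟩
      rw [fourier_re_coe]
      simpa [hc] using hc2
    · refine ⟨2, by norm_num, le_rfl, ?_⟩
      rw [fourier_re_coe]
      have e : 2 * Real.pi * ((((2 : ℕ) : ℤ) * ((2 ^ N : ℕ) : ℤ) : ℤ) * y) =
          2 * (2 * Real.pi * ((2 ^ N : ℕ) * y)) := by push_cast; ring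
      rw [e, Real.cos_two_mul, ← hc]
      have h4 := abs_lt.1 (not_le.1 hc2)
      rw [abs_of_nonpos] <;> nlinarith [h4.1, h4.2]
  obtain ⟨n, hn⟩ : ∃ n, n + 1 = j * 2 ^ N := ⟨j * 2 ^ N - 1, by
    have : 0 < j * 2 ^ N := by positivity
    omega⟩
  -- Consecutive partial sums isolate the frequencies `±(n + 1)`, beyond the degree of `h`. A large
  -- difference forces one of the two sums to be large.
  have hdecomp : partialSumCLM (n + 1) x f - partialSumCLM n x f =
      fourier (n + 1 : ℤ) x * fourierCoeffCLM (n + 1) f +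
        fourier (-(n + 1) : ℤ) x * fourierCoeffCLM (-(n + 1)) f := by
    rw [partialSumCLM_apply, partialSumCLM_apply, Finset.sum_Icc_neg_succ]
    ring
  have hnN : N < n + 1 := by
    have h1 : N < 2 ^ N := Nat.lt_two_pow_self
    nlinarith
  have hcoeff : ∀ k : ℤ, |k| = n + 1 → fourierCoeffCLM k f =
      (N : ℂ)⁻¹ * (fejerWeight (2 ^ N) (2 ^ (N ^ 2 + 1)) k : ℂ) + fourierCoeffCLM k r := by
    intro k hk
    conv_lhs => rw [hfr]
    rw [map_add, map_add, hdeg k (by omega), zero_add, map_smul, smul_eq_mul, spike,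
      fourierCoeffCLM_dilatedFejerL1]
  have hjn : ((n : ℤ) + 1) = (j : ℤ) * (2 ^ N : ℕ) := by exact_mod_cast hn
  have hL : (4 : ℤ) ≤ ((2 ^ (N ^ 2 + 1) : ℕ) : ℤ) := by
    have : 2 ^ 2 ≤ 2 ^ (N ^ 2 + 1) := Nat.pow_le_pow_right two_pos (by nlinarith)
    exact_mod_cast this
  have hw1 : 1 / 2 ≤ fejerWeight (2 ^ N) (2 ^ (N ^ 2 + 1)) (n + 1) := by
    rw [hjn]
    exact half_le_fejerWeight (by positivity) (by rw [Nat.abs_cast]; omega)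
  have hw2 : 1 / 2 ≤ fejerWeight (2 ^ N) (2 ^ (N ^ 2 + 1)) (-(n + 1)) := by
    rw [hjn, ← neg_mul]
    exact half_le_fejerWeight (by positivity) (by rw [abs_neg, Nat.abs_cast]; omega)
  set w₁ := fejerWeight (2 ^ N) (2 ^ (N ^ 2 + 1)) (n + 1)
  set w₂ := fejerWeight (2 ^ N) (2 ^ (N ^ 2 + 1)) (-(n + 1))
  rw [← hjn] at hcos
  set z := fourier (n + 1 : ℤ) x with hz
  have hzn : ‖z‖ = 1 := norm_fourier_apply _ _
  have hmain : 1 / (4 * N) ≤ ‖partialSumCLM (n + 1) x f - partialSumCLM n x f‖ := by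
    rw [hdecomp, hcoeff (n + 1) (abs_of_nonneg (by positivity)),
      hcoeff (-(n + 1)) (by rw [abs_neg]; exact abs_of_nonneg (by positivity)), fourier_neg, ← hz]
    have e : z * ((N : ℂ)⁻¹ * (w₁ : ℂ) + fourierCoeffCLM (n + 1) r) +
        (starRingEnd ℂ) z * ((N : ℂ)⁻¹ * (w₂ : ℂ) + fourierCoeffCLM (-(n + 1)) r) =
        (N : ℂ)⁻¹ * (w₁ * z + w₂ * (starRingEnd ℂ) z) - (-(z * fourierCoeffCLM (n + 1) r) -
          (starRingEnd ℂ) z * fourierCoeffCLM (-(n + 1)) r) := by ring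
    rw [e]
    refine le_trans ?_ (norm_sub_norm_le _ _)
    have h1 : ‖-(z * fourierCoeffCLM (n + 1) r) -
        (starRingEnd ℂ) z * fourierCoeffCLM (-(n + 1)) r‖ ≤ 1 / (8 * N) + 1 / (8 * N) := by
      refine (norm_sub_le _ _).trans ?_
      rw [norm_neg, norm_mul, norm_mul, RCLike.norm_conj, hzn, one_mul, one_mul]
      exact add_le_add ((norm_fourierCoeffCLM_apply_le _ r).trans hrle)
        ((norm_fourierCoeffCLM_apply_le _ r).trans hrle)
    have h2 : 1 / 2 ≤ ‖(w₁ : ℂ) * z + w₂ * (starRingEnd ℂ) z‖ := by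
      refine le_trans ?_ (Complex.abs_re_le_norm _)
      rw [Complex.add_re, Complex.re_ofReal_mul, Complex.re_ofReal_mul, Complex.conj_re,
        ← add_mul, abs_mul, abs_of_nonneg (by linarith)]
      nlinarith [abs_nonneg z.re]
    rw [norm_mul, norm_inv, Complex.norm_natCast]
    have h3 : (N : ℝ)⁻¹ * (1 / 2) ≤ (N : ℝ)⁻¹ * ‖(w₁ : ℂ) * z + w₂ * (starRingEnd ℂ) z‖ := by gcongr
    have h4 : 1 / (4 * N : ℝ) = (N : ℝ)⁻¹ * (1 / 2) - (1 / (8 * N) + 1 / (8 * N)) := by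
      field_simp; norm_num
    linarith
  have hn1 : 2 ^ (N - 1) ≤ n := by
    have h1 : 2 ^ N = 2 * 2 ^ (N - 1) := by rw [← pow_succ']; congr 1; omega
    have h2 : 1 * 2 ^ N ≤ j * 2 ^ N := Nat.mul_le_mul_right _ hj1
    have h3 : 0 < 2 ^ (N - 1) := by positivity
    omega
  simp only [fourierPartialSum_eq_partialSumCLM]
  by_contra! hcon
  have h1 := hcon n hn1
  have h2 := hcon (n + 1) (by omega)
  have h3 := norm_sub_le (partialSumCLM (n + 1) x f) (partialSumCLM n x f)
  have h4 : 1 / (4 * N : ℝ) = 1 / (8 * N) + 1 / (8 * N) := by field_simp; norm_num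
  linarith

/-! ### Growth exponents and the upper bound for level sets -/

lemma le_log_enorm_div_log_iff {n : ℕ} (hn : 2 ≤ n) (γ : ℝ) (z : ℂ) :
    (γ : EReal) ≤ ENNReal.log ‖z‖ₑ / ((Real.log n : ℝ) : EReal) ↔ (n : ℝ) ^ γ ≤ ‖z‖ := by
  have hn1 : (1 : ℝ) < n := by exact_mod_cast hn
  have hn0 : (0 : ℝ) < n := by linarith
  have hlog := Real.log_pos hn1
  rw [EReal.le_div_iff_mul_le (by exact_mod_cast hlog) (EReal.coe_ne_top _), ← EReal.coe_mul,
    ← Real.log_rpow hn0, ← ENNReal.log_ofReal_of_pos (Real.rpow_pos_of_pos hn0 _),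
    ENNReal.log_le_log_iff, ← ofReal_norm, ENNReal.ofReal_le_ofReal_iff (norm_nonneg _)]

/-- The upper growth exponent of the partial sums of the Fourier series of `f` at `x`. -/
noncomputable def growthExponent (f : UnitAddCircle → ℂ) (x : UnitAddCircle) : EReal :=
  limsup (fun n : ℕ => ENNReal.log ‖fourierPartialSum n f x‖ₑ / ((Real.log n : ℝ) : EReal)) atTop

lemma mem_fastGrowthSet_of_lt_growthExponent {f : UnitAddCircle → ℂ} {x : UnitAddCircle} {γ : ℝ}
    (h : (γ : EReal) < growthExponent f x) : x ∈ fastGrowthSet γ f :=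
  ((frequently_lt_of_lt_limsup (by isBoundedDefault) h).and_eventually
    (eventually_ge_atTop 2)).mono fun _ hn => (le_log_enorm_div_log_iff hn.2 _ _).1 hn.1.le

lemma le_growthExponent_of_mem_fastGrowthSet {f : UnitAddCircle → ℂ} {x : UnitAddCircle} {γ : ℝ}
    (h : x ∈ fastGrowthSet γ f) : (γ : EReal) ≤ growthExponent f x :=
  le_limsup_of_frequently_le ((Frequently.and_eventually h (eventually_ge_atTop 2)).mono
    fun _ hn => (le_log_enorm_div_log_iff hn.2 _ _).2 hn.1) (by isBoundedDefault)

lemma fastGrowthSet_anti {f : UnitAddCircle → ℂ} {γ γ' : ℝ} (h : γ ≤ γ') :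
    fastGrowthSet γ' f ⊆ fastGrowthSet γ f := by
  intro x hx
  refine (Frequently.and_eventually hx (eventually_ge_atTop 1)).mono fun n hn => le_trans ?_ hn.1
  exact Real.rpow_le_rpow_of_exponent_le (by exact_mod_cast hn.2) h

lemma le_growthExponent_of_forall_lt {f : UnitAddCircle → ℂ} {x : UnitAddCircle} {β : ℝ}
    (h : ∀ γ < β, x ∈ fastGrowthSet γ f) : (β : EReal) ≤ growthExponent f x :=
  EReal.ge_of_forall_gt_iff_ge.1 fun γ hγ =>
    le_growthExponent_of_mem_fastGrowthSet (h γ (by exact_mod_cast hγ))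

lemma dimH_divergenceLevelSet_le {f : UnitAddCircle → ℂ}
    (hf : Integrable f AddCircle.haarAddCircle) {β : ℝ} (hβ : 0 ≤ β) :
    dimH (divergenceLevelSet β f) ≤ ENNReal.ofReal (1 - β) := by
  rcases hβ.eq_or_lt with rfl | hpos
  · simpa using dimH_unitAddCircle_le _
  have ht : Tendsto (fun γ : ℝ => ENNReal.ofReal (1 - γ)) (nhdsWithin β (Set.Iio β))
      (nhds (ENNReal.ofReal (1 - β))) :=
    ((ENNReal.continuous_ofReal.comp (continuous_sub_left 1)).tendsto β).mono_left
      nhdsWithin_le_nhds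
  refine ge_of_tendsto ht ?_
  filter_upwards [Ioo_mem_nhdsLT hpos] with γ hγ
  refine (dimH_mono fun x hx => ?_).trans (dimH_fastGrowthSet_le hf hγ.1)
  refine mem_fastGrowthSet_of_lt_growthExponent ?_
  have hx' : growthExponent f x = (β : EReal) := hx
  rw [hx']
  exact_mod_cast hγ.2

/-! ### Lower bound for level sets through the Cantor-type map -/

lemma dimH_le_dimH_image_div_of_dist_le {X Y : Type*} [MetricSpace X] [MetricSpace Y] {H : X → Y}
    {A : Set X} {K s : ℝ} (hs : 0 < s)
    (h : ∀ t ∈ A, ∀ u ∈ A, dist t u ≤ K * dist (H t) (H u) ^ s) :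
    dimH A ≤ dimH (H '' A) / ENNReal.ofReal s := by
  rcases isEmpty_or_nonempty X with hX | hX
  · simp [Set.eq_empty_of_isEmpty A]
  have hinj : Set.InjOn H A := by
    intro t ht u hu htu
    have := h t ht u hu
    rw [htu, dist_self, Real.zero_rpow hs.ne', mul_zero] at this
    exact dist_le_zero.1 this
  set g := Function.invFunOn H A with hg
  have hgl : ∀ t ∈ A, g (H t) = t := fun t ht => hinj.leftInvOn_invFunOn ht
  have himg : g '' (H '' A) = A := by
    rw [Set.image_image]
    exact (Set.image_congr hgl).trans (Set.image_id' A)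
  have hhol : HolderOnWith K.toNNReal s.toNNReal g (H '' A) := by
    rintro _ ⟨t, ht, rfl⟩ _ ⟨u, hu, rfl⟩
    rw [hgl t ht, hgl u hu, edist_dist, edist_dist, Real.coe_toNNReal s hs.le,
      ENNReal.ofReal_rpow_of_nonneg dist_nonneg hs.le, ← ENNReal.ofReal, ← ENNReal.ofReal_mul' (by positivity)]
    exact ENNReal.ofReal_le_ofReal (h t ht u hu)
  have := hhol.dimH_image_le (Real.toNNReal_pos.2 hs)
  rwa [himg] at this

/-- If a map whose inverse is Hölder continuous of every exponent `s < 1 - β` takes values in the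
points of growth exponent at least `β`, then the level set of exponent `β` has dimension at
least `1 - β`. -/
lemma le_dimH_divergenceLevelSet {f : UnitAddCircle → ℂ}
    (hf : Integrable f AddCircle.haarAddCircle) {β : ℝ} (hβ0 : 0 ≤ β) (hβ1 : β < 1)
    {H : ℝ → UnitAddCircle}
    (hH : ∀ s : ℝ, 0 < s → s < 1 - β → ∃ K : ℝ, ∀ t ∈ Set.Ico (0 : ℝ) 1,
      ∀ u ∈ Set.Ico (0 : ℝ) 1, dist t u ≤ K * dist (H t) (H u) ^ s)
    (hgrowth : ∀ t ∈ Set.Ico (0 : ℝ) 1, (β : EReal) ≤ growthExponent f (H t)) :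
    ENNReal.ofReal (1 - β) ≤ dimH (divergenceLevelSet β f) := by
  set A : Set ℝ := {t | t ∈ Set.Ico (0 : ℝ) 1 ∧ H t ∈ divergenceLevelSet β f} with hA
  set B : ℕ → Set ℝ := fun k =>
    {t | t ∈ Set.Ico (0 : ℝ) 1 ∧ H t ∈ fastGrowthSet (β + 1 / (k + 1)) f} with hB
  have hdim : ∀ S : Set UnitAddCircle, ∀ s : ℝ, 0 < s → s < 1 - β →
      dimH {t | t ∈ Set.Ico (0 : ℝ) 1 ∧ H t ∈ S} ≤ dimH S / ENNReal.ofReal s := by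
    intro S s hs0 hs1
    obtain ⟨K, hK⟩ := hH s hs0 hs1
    refine (dimH_le_dimH_image_div_of_dist_le hs0 fun t ht u hu => hK t ht.1 u hu.1).trans ?_
    gcongr
    rintro _ ⟨t, ht, rfl⟩
    exact ht.2
  have hcover : Set.Ico (0 : ℝ) 1 ⊆ A ∪ ⋃ k, B k := by
    intro t ht
    rcases (hgrowth t ht).eq_or_lt with h | h
    · exact Or.inl ⟨ht, h.symm⟩
    · obtain ⟨γ, hγ1, hγ2⟩ := EReal.lt_iff_exists_real_btwn.1 h
      have hγ1' : β < γ := by exact_mod_cast hγ1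
      obtain ⟨k, hk⟩ := exists_nat_one_div_lt (sub_pos.2 hγ1')
      refine Or.inr (Set.mem_iUnion.2 ⟨k, ht, ?_⟩)
      exact fastGrowthSet_anti (by linarith) (mem_fastGrowthSet_of_lt_growthExponent hγ2)
  have hBnull : ∀ k, volume (B k) = 0 := by
    intro k
    have hk : (0 : ℝ) < 1 / (k + 1) := by positivity
    -- An exponent `s` strictly between the dimension bound for this fast growth set and `1 - β`
    -- makes the quotient less than `1`, so `B k` is Lebesgue null.
    obtain ⟨s, hs1, hs2⟩ := exists_between
      (max_lt (sub_pos.2 hβ1) (show 1 - (β + 1 / ((k : ℝ) + 1)) < 1 - β by linarith))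
    have hs0 : 0 < s := (le_max_left _ _).trans_lt hs1
    have hlt : dimH (B k) < ((1 : NNReal) : ℝ≥0∞) := by
      refine (hdim _ s hs0 hs2).trans_lt ?_
      rw [ENNReal.coe_one, ENNReal.div_lt_iff (Or.inl (by simpa using hs0))
        (Or.inl ENNReal.ofReal_ne_top), one_mul]
      exact (dimH_fastGrowthSet_le hf (by positivity)).trans_lt
        ((ENNReal.ofReal_lt_ofReal_iff hs0).2 (lt_of_le_of_lt (le_max_right _ _) hs1))
    have := hausdorffMeasure_of_dimH_lt hlt
    rwa [NNReal.coe_one, hausdorffMeasure_real] at this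
  have hA1 : 1 ≤ dimH A := by
    by_contra! hcon
    have hA0 : volume A = 0 := by
      have := hausdorffMeasure_of_dimH_lt (d := 1) (by simpa using hcon)
      rwa [NNReal.coe_one, hausdorffMeasure_real] at this
    have h0 : volume (Set.Ico (0 : ℝ) 1) = 0 :=
      measure_mono_null hcover (measure_union_null hA0 (measure_iUnion_null hBnull))
    simp at h0
  refine le_of_forall_lt_imp_le_of_dense fun d hd => ?_
  obtain ⟨s, hs, hsd⟩ := ENNReal.lt_iff_exists_nnreal_btwn.1 hd
  rw [← ENNReal.ofReal_coe_nnreal, ENNReal.ofReal_lt_ofReal_iff (by linarith)] at hsd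
  have hs0 : (0 : ℝ) < s := by
    have : (0 : ℝ≥0∞) < s := zero_le.trans_lt hs
    exact_mod_cast this
  have h := hA1.trans (hdim _ s hs0 hsd)
  rw [ENNReal.le_div_iff_mul_le (Or.inl (ENNReal.ofReal_pos.2 hs0).ne') (Or.inl ENNReal.ofReal_ne_top),
    one_mul, ENNReal.ofReal_coe_nnreal] at h
  exact hs.le.trans h

/-! ### Asymptotics of the spikes and conclusion -/

lemma tendsto_floor_natCast_div_atTop {τ : ℝ} (hτ : 0 < τ) :
    Tendsto (fun N : ℕ => ⌊(N : ℝ) / τ⌋₊) atTop atTop :=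
  tendsto_nat_floor_atTop.comp (tendsto_natCast_atTop_atTop.atTop_div_const hτ)

/-- For `m = ⌊N / τ⌋₊`, `2 ^ (m - N)` is comparable to at least `2 ^ ((1 - τ) m)`, which exceeds `2
^ (γ m)` by the exponential factor `2 ^ (κ m)`; this beats all polynomial losses. -/
lemma eventually_rpow_le_spike_bound {τ γ : ℝ} (hτ : 0 < τ) (hγ0 : 0 ≤ γ) (hγ : γ < 1 - τ) :
    ∀ᶠ N : ℕ in atTop, N + 3 ≤ ⌊(N : ℝ) / τ⌋₊ ∧ ⌊(N : ℝ) / τ⌋₊ ≤ N ^ 2 ∧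
      (((2 : ℕ) ^ (⌊(N : ℝ) / τ⌋₊ - 3) : ℕ) : ℝ) ^ γ ≤
        (2 : ℝ) ^ (⌊(N : ℝ) / τ⌋₊ - 3 - N) / (4 * N) - ((2 * N + 1) * N + 1) := by
  set κ := 1 - τ - γ with hκ
  have hκ0 : 0 < κ := by linarith
  -- `320 = 16 * 20`: `16` from the shift by `3` and the rounding in `m`, `20 m ^ 3` from the
  -- polynomial terms times `4 N`.
  have hpoly : ∀ᶠ m : ℕ in atTop, 320 * (m : ℝ) ^ 3 ≤ (2 : ℝ) ^ (κ * m) := by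
    have hr : |(2 : ℝ) ^ (-κ)| < 1 := by
      rw [abs_of_pos (by positivity)]
      exact Real.rpow_lt_one_of_one_lt_of_neg (by norm_num) (by linarith)
    have ht := tendsto_pow_const_mul_const_pow_of_abs_lt_one 3 hr
    filter_upwards [ht.eventually_lt_const (show (0 : ℝ) < 1 / 320 by norm_num)] with m hm
    rw [← Real.rpow_natCast ((2 : ℝ) ^ (-κ)), ← Real.rpow_mul (by norm_num), neg_mul,
      Real.rpow_neg (by norm_num), ← div_eq_mul_inv, div_lt_iff₀ (by positivity)] at hm
    linarith
  have hN1 : ∀ᶠ N : ℕ in atTop, (4 : ℝ) ≤ N * (1 / τ - 1) := by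
    have : 0 < 1 / τ - 1 := by
      rw [sub_pos, lt_div_iff₀ hτ]; linarith
    exact (tendsto_natCast_atTop_atTop.atTop_mul_const this).eventually_ge_atTop 4
  filter_upwards [hN1, (tendsto_floor_natCast_div_atTop hτ).eventually hpoly,
    tendsto_natCast_atTop_atTop.eventually_ge_atTop (1 / τ), eventually_ge_atTop 1]
    with N h1 h2 h3 h4
  have hN0 : (0 : ℝ) < N := by exact_mod_cast h4
  have hfl := Nat.lt_floor_add_one ((N : ℝ) / τ)
  have hfl2 := Nat.floor_le (show 0 ≤ (N : ℝ) / τ by positivity)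
  have e : (N : ℝ) / τ = N * (1 / τ) := by ring
  have hm3 : N + 3 ≤ ⌊(N : ℝ) / τ⌋₊ := by
    apply Nat.le_floor
    push_cast
    rw [e]; linarith
  have hm2 : ⌊(N : ℝ) / τ⌋₊ ≤ N ^ 2 := by
    have : (⌊(N : ℝ) / τ⌋₊ : ℝ) ≤ (N : ℝ) ^ 2 := by
      refine hfl2.trans ?_
      rw [e, sq]
      gcongr
    exact_mod_cast this
  refine ⟨hm3, hm2, ?_⟩
  set m := ⌊(N : ℝ) / τ⌋₊
  have hNm : (N : ℝ) ≤ τ * (m + 1) := by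
    rw [div_lt_iff₀ hτ] at hfl; linarith
  have hNm' : (N : ℝ) ≤ m := by exact_mod_cast (show N ≤ m by omega)
  have hm1 : (1 : ℝ) ≤ m := by exact_mod_cast (show 1 ≤ m by omega)
  have hleft : (((2 : ℕ) ^ (m - 3) : ℕ) : ℝ) ^ γ ≤ (2 : ℝ) ^ (γ * m) := by
    push_cast
    rw [mul_comm, Real.rpow_mul (by norm_num), Real.rpow_natCast]
    gcongr
    · norm_num
    · omega
  have hG1 : (1 : ℝ) ≤ 2 ^ (γ * m) := Real.one_le_rpow (by norm_num) (by positivity)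
  have hright : (2 : ℝ) ^ (κ * m) * 2 ^ (γ * m) ≤ 16 * (2 : ℝ) ^ (m - 3 - N) := by
    rw [← Real.rpow_add (by norm_num), ← Real.rpow_natCast 2 (m - 3 - N),
      show (16 : ℝ) = 2 ^ (4 : ℝ) by norm_num, ← Real.rpow_add (by norm_num)]
    apply Real.rpow_le_rpow_of_exponent_le (by norm_num)
    rw [Nat.cast_sub (by omega), Nat.cast_sub (by omega)]
    push_cast
    have : κ * m + γ * m = (1 - τ) * m := by rw [hκ]; ring
    rw [this]
    linarith
  rw [le_sub_iff_add_le, le_div_iff₀ (by positivity)]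
  set G := (2 : ℝ) ^ (γ * m)
  have hsum : (((2 : ℕ) ^ (m - 3) : ℕ) : ℝ) ^ γ + ((2 * N + 1) * N + 1) ≤ G * (5 * (m : ℝ) ^ 2) := by
    have h5 : (2 * (N : ℝ) + 1) * N + 1 ≤ 4 * (m : ℝ) ^ 2 := by nlinarith
    have h6 : (4 : ℝ) * (m : ℝ) ^ 2 ≤ G * (4 * (m : ℝ) ^ 2) := by
      nlinarith [sq_nonneg (m : ℝ)]
    have h7 : G ≤ G * (m : ℝ) ^ 2 :=
      le_mul_of_one_le_right (by linarith) (one_le_pow₀ hm1)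
    linarith
  calc _ ≤ G * (5 * (m : ℝ) ^ 2) * (4 * m) := by gcongr
    _ = 20 * (m : ℝ) ^ 3 * G := by ring
    _ ≤ (2 : ℝ) ^ (m - 3 - N) := by nlinarith

lemma mem_fastGrowthSet_of_near_dyadic {f : L1Circle} {τ γ : ℝ} (hτ : 0 < τ) (hγ0 : 0 ≤ γ)
    (hγ : γ < 1 - τ) {N : ℕ → ℕ} (hN : Tendsto N atTop atTop) (hspike : ∀ i, HasSpikeAt f (N i))
    {x : UnitAddCircle}
    (hx : ∀ i, ∃ (k : ℕ) (δ : ℝ), x = ((k / 2 ^ N i + δ : ℝ) : UnitAddCircle) ∧ 0 ≤ δ ∧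
      δ ≤ ((2 : ℝ) ^ ⌊(N i : ℝ) / τ⌋₊)⁻¹) :
    x ∈ fastGrowthSet γ (f : UnitAddCircle → ℂ) := by
  have hn : Tendsto (fun i => 2 ^ (⌊(N i : ℝ) / τ⌋₊ - 3)) atTop atTop :=
    (tendsto_pow_atTop_atTop_of_one_lt one_lt_two).comp
      ((tendsto_sub_atTop_nat 3).comp ((tendsto_floor_natCast_div_atTop hτ).comp hN))
  refine hn.frequently (Eventually.frequently ?_)
  filter_upwards [hN.eventually (eventually_rpow_le_spike_bound hτ hγ0 hγ),
    hN.eventually_ge_atTop 1] with i hi hi1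
  obtain ⟨k, δ, rfl, hδ0, hδ⟩ := hx i
  exact hi.2.2.trans ((hspike i).le_norm_fourierPartialSum hi1 hi.1 hi.2.1 hδ0 hδ)

/-- At every point some partial sum of order `n ≥ 2 ^ (N - 1)` is at least `1 / (8 N)`, only
logarithmically small in the scale. This gives exponent at least `0` everywhere and settles `β = 0`,
where the near-dyadic estimate says nothing. -/
lemma mem_fastGrowthSet_of_neg {f : L1Circle} (hf : ∃ᶠ N : ℕ in atTop, HasSpikeAt f N) {γ : ℝ}
    (hγ : γ < 0) (x : UnitAddCircle) : x ∈ fastGrowthSet γ (f : UnitAddCircle → ℂ) := by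
  refine frequently_atTop.2 fun K => ?_
  have hr : |(2 : ℝ) ^ γ| < 1 := by
    rw [abs_of_pos (by positivity)]
    exact Real.rpow_lt_one_of_one_lt_of_neg (by norm_num) hγ
  have ht := (tendsto_pow_const_mul_const_pow_of_abs_lt_one 1 hr).eventually_lt_const
    (show (0 : ℝ) < 2 ^ γ / 8 by positivity)
  obtain ⟨N, hN, hN1, hNK, hNt⟩ := (hf.and_eventually ((eventually_ge_atTop 1).and
    ((eventually_ge_atTop (K + 1)).and ht))).exists
  obtain ⟨n, hn, hle⟩ := hN.exists_le_norm_fourierPartialSum hN1 x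
  have hNn : N - 1 < 2 ^ (N - 1) := Nat.lt_two_pow_self
  refine ⟨n, by omega, le_trans ?_ hle⟩
  have hN0 : (0 : ℝ) < N := by exact_mod_cast hN1
  have h2 : ((2 : ℝ) ^ (N - 1)) ≤ n := by exact_mod_cast hn
  calc (n : ℝ) ^ γ ≤ ((2 : ℝ) ^ (N - 1)) ^ γ :=
        Real.rpow_le_rpow_of_nonpos (by positivity) h2 hγ.le
    _ = ((2 : ℝ) ^ γ) ^ N / 2 ^ γ := by
      rw [eq_div_iff (by positivity), ← Real.rpow_natCast, ← Real.rpow_natCast,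
        ← Real.rpow_mul (by norm_num), ← Real.rpow_mul (by norm_num),
        ← Real.rpow_add (by norm_num), Nat.cast_sub hN1]
      congr 1
      push_cast
      ring
    _ ≤ 1 / (8 * N) := by
      rw [div_le_div_iff₀ (by positivity) (by positivity)]
      rw [pow_one] at hNt
      linarith

lemma exists_sparse_of_frequently {p : ℕ → Prop} (h : ∃ᶠ N in atTop, p N) (g : ℕ → ℕ → ℕ) :
    ∃ N : ℕ → ℕ, 1 ≤ N 0 ∧ (∀ i, p (N i)) ∧ ∀ i, g i (N i) ≤ N (i + 1) := by
  choose next hnext hp using fun K => (frequently_atTop.1 h) K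
  let N : ℕ → ℕ := fun i => Nat.rec (next 1) (fun i n => next (g i n)) i
  refine ⟨N, hnext 1, fun i => ?_, fun i => hnext _⟩
  cases i with
  | zero => exact hp 1
  | succ i => exact hp _

/-- For an integrable function with infinitely many spikes the level set of exponent `β` has full
dimension `1 - β`. -/
theorem dimH_divergenceLevelSet_eq {f : L1Circle} (hf : ∃ᶠ N : ℕ in atTop, HasSpikeAt f N)
    {β : ℝ} (hβ0 : 0 ≤ β) (hβ1 : β ≤ 1) :
    dimH (divergenceLevelSet β (f : UnitAddCircle → ℂ)) = ENNReal.ofReal (1 - β) := by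
  refine le_antisymm (dimH_divergenceLevelSet_le (L1.integrable_coeFn f) hβ0) ?_
  rcases hβ1.eq_or_lt with rfl | hβ1
  · simp
  have hτ : 0 < 1 - β := by linarith
  obtain ⟨N, hN0, hspike, hsparse⟩ := exists_sparse_of_frequently hf
    -- The first entry forces the levels to infinity; the second is the sparseness needed by the
    -- digit count.
    fun i n => max (i + 1) ((i + 1) * ⌊(n : ℝ) / (1 - β)⌋₊)
  have hNtop : Tendsto N atTop atTop := (tendsto_add_atTop_iff_nat 1).1
    (tendsto_atTop_mono (fun i => (le_max_left _ _).trans (hsparse i)) (tendsto_add_atTop_nat 1))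
  obtain ⟨H, hH, hdyadic⟩ := exists_map_near_dyadic (N := N)
    (m := fun i => ⌊(N i : ℝ) / (1 - β)⌋₊) (τ := 1 - β) (by linarith) hN0
    (fun i => Nat.le_floor (by
      rw [le_div_iff₀ hτ]; nlinarith [Nat.cast_nonneg (α := ℝ) (N i)]))
    (fun i => by
      have := Nat.floor_le (show 0 ≤ (N i : ℝ) / (1 - β) by positivity)
      rw [le_div_iff₀ hτ] at this
      linarith)
    (fun i => (le_max_right _ _).trans (hsparse i))
  refine le_dimH_divergenceLevelSet (L1.integrable_coeFn f) hβ0 hβ1 hH fun t _ => ?_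
  refine le_growthExponent_of_forall_lt fun γ hγ => ?_
  rcases lt_or_ge γ 0 with hγ0 | hγ0
  · exact mem_fastGrowthSet_of_neg hf hγ0 _
  · exact mem_fastGrowthSet_of_near_dyadic hτ hγ0 (by linarith) hNtop hspike fun i => hdyadic i t

theorem theorem3 :
    ∀ᶠ f : L1Circle in residual L1Circle,
      ∀ β : ℝ, 0 ≤ β → β ≤ 1 →
        dimH (divergenceLevelSet β (f : UnitAddCircle → ℂ)) = ENNReal.ofReal (1 - β) :=
  eventually_residual_frequently_hasSpikeAt.mono fun _ hf _ hβ0 hβ1 =>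
    dimH_divergenceLevelSet_eq hf hβ0 hβ1
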